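/- Let $n\ge 3$, let $\mathbb{B}^n$ be the open unit ball of $\mathbb{R}^n$ with Euclidean norm $|\cdot|$, and let $h:\mathbb{B}^n\to(-1,1)$ be hyperbolic harmonic, i.e. $h$ is of class $C^2$ and $\Delta_h h=0$ on $\mathbb{B}^n$, where $$\Delta_h u(x)=(1-|x|^2)^2\,\Delta u(x)+2(n-2)(1-|x|^2)\sum_{i=1}^n x_i\frac{\partial u}{\partial x_i}(x)$$ and $\Delta$ is the Laplacian on $\mathbb{R}^n$. Then $$|\nabla h(x)|\le (n-1)\,\frac{1-|h(x)|^2}{1-|x|^2},\qquad x\in\mathbb{B}^n .$$ Consequently, $$d_{h_2}\big(h(x_1),h(x_2)\big)\le (n-1)\,d_{h_n}(x_1,x_2),\qquad x_1,x_2\in\mathbb{B}^n,$$ where, for $m\ge 2$, $d_{h_m}$ denotes the hyperbolic distance of $\mathbb{B}^m$, that is, $d_{h_m}(x,y)$ is the infimum of $\int_0^1 \frac{2|\gamma'(t)|}{1-|\gamma(t)|^2}\,dt$ over all $C^1$ curves $\gamma:[0,1]\to\mathbb{B}^m$ from $x$ to $y$. For $m=2$ it is the Poincaré distance of the unit disc,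 and $(-1,1)$ is identified with the real diameter $\{(t,0):-1<t<1\}$ of that disc. -/

import Mathlib

open Set InnerProductSpace
open scoped Gradient

noncomputable section

/-- The open unit ball of Euclidean `ℝⁿ`. -/
def unitBall (n : ℕ) : Set (EuclideanSpace ℝ (Fin n)) := Metric.ball 0 1

/-- The hyperbolic Laplacian
`Δ_h u(x) = (1 - |x|²)² Δu(x) + 2(n - 2)(1 - |x|²) ∑ xᵢ ∂u/∂xᵢ(x)`. -/
def hyperbolicLaplacian {n : ℕ} (u : EuclideanSpace ℝ (Fin n) → ℝ)
    (x : EuclideanSpace ℝ (Fin n)) : ℝ :=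
  (1 - ‖x‖ ^ 2) ^ 2 * Laplacian.laplacian u x
    + 2 * ((n : ℝ) - 2) * (1 - ‖x‖ ^ 2)
      * ∑ i : Fin n, x i * fderiv ℝ u x (EuclideanSpace.single i 1)

/-- `u` is of class `C²` on the unit ball and `Δ_h u = 0` there. Only the values of `u` on the
open unit ball matter. -/
def IsHyperbolicHarmonic {n : ℕ} (u : EuclideanSpace ℝ (Fin n) → ℝ) : Prop :=
  ContDiffOn ℝ 2 u (unitBall n) ∧ ∀ x ∈ unitBall n, hyperbolicLaplacian u x = 0

/-- `γ`, restricted to `[0, 1]`, is a `C¹` curve in the unit ball from `x` to `y`. -/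
structure IsBallCurve {n : ℕ} (γ : ℝ → EuclideanSpace ℝ (Fin n))
    (x y : EuclideanSpace ℝ (Fin n)) : Prop where
  contDiffOn : ContDiffOn ℝ 1 γ (Icc 0 1)
  mapsTo : MapsTo γ (Icc 0 1) (unitBall n)
  source : γ 0 = x
  target : γ 1 = y

/-- The length over `[0, 1]` of a curve for the metric `2|dx| / (1 - |x|²)` of constant
curvature `-1`. -/
def hyperbolicLength {n : ℕ} (γ : ℝ → EuclideanSpace ℝ (Fin n)) : ℝ :=
  ∫ t in (0 : ℝ)..1, 2 * ‖derivWithin γ (Icc 0 1) t‖ / (1 - ‖γ t‖ ^ 2)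

/-- The hyperbolic distance of the unit ball: the infimum of the hyperbolic lengths of curves
joining two points. For `n = 2` this is the Poincaré distance of the unit disc. -/
def hyperbolicDist {n : ℕ} (x y : EuclideanSpace ℝ (Fin n)) : ℝ :=
  sInf {L : ℝ | ∃ γ : ℝ → EuclideanSpace ℝ (Fin n), IsBallCurve γ x y ∧ L = hyperbolicLength γ}

end

/-!
A radial weight turns the divergence theorem for `∇h` into a mean value property
`∫ w(|x|²) h = h(0) ∫ w`, and hyperbolic harmonicity is invariant under the ball-preserving
inversions. Moving the weight with such an inversion represents `h(te)`, and differentiating at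
`t = 0` gives `Dh(0)e ∫ m = ∫ 2⟪e, x⟫ w h` for a companion weight `w`. Since `|h| < 1`, adding
`2 h(0) ∫ w h = 2 h(0)² ∫ w` bounds the left side in terms of `∫ w |⟪e, x⟫ + h(0)|`. For `n ≥ 3`
the coordinate `⟪e, x⟫` on the sphere is at least as concentrated as the uniform distribution on
`[-1, 1]`, so that integral is at most `(1 + h(0)²)/2 ∫ w`. Letting the weights concentrate at the
sphere yields `|Dh(0)| ≤ (n - 1)(1 - h(0)²)`; an inversion moves `0` to any other point, and
integration along curves gives the statement about distances.
-/

open MeasureTheory Metric Module Filter Topology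

section Divergence

variable {E : Type*} [NormedAddCommGroup E] [InnerProductSpace ℝ E] {V W : E → E} {f : E → ℝ}
  {x : E}

/-- The divergence of a vector field, as the trace of its derivative. -/
noncomputable def divergence (V : E → E) (x : E) : ℝ := LinearMap.trace ℝ E (fderiv ℝ V x)

theorem divergence_sub (hV : DifferentiableAt ℝ V x) (hW : DifferentiableAt ℝ W x) :
    divergence (fun y ↦ V y - W y) x = divergence V x - divergence W x := by
  simp [divergence, fderiv_fun_sub hV hW]

theorem divergence_const (v : E) : divergence (fun _ ↦ v) x = 0 := by
  simp [divergence]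

variable [FiniteDimensional ℝ E]

theorem divergence_id : divergence (fun y : E ↦ y) x = finrank ℝ E := by
  simp [divergence, LinearMap.trace_id]

theorem divergence_smul (hf : DifferentiableAt ℝ f x) (hV : DifferentiableAt ℝ V x) :
    divergence (fun y ↦ f y • V y) x = fderiv ℝ f x (V x) + f x * divergence V x := by
  rw [divergence, fderiv_fun_smul hf hV]
  simp [divergence, LinearMap.trace_smulRight, add_comm]

theorem divergence_eq_sum_inner (V : E → E) (x : E) :
    divergence V x = ∑ i, ⟪stdOrthonormalBasis ℝ E i, fderiv ℝ V x (stdOrthonormalBasis ℝ E i)⟫_ℝ :=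
  LinearMap.trace_eq_sum_inner _ _

theorem divergence_gradient (f : E → ℝ) (x : E) :
    divergence (gradient f) x = Laplacian.laplacian f x := by
  have hfd : fderiv ℝ (gradient f) x =
      (toDual ℝ E).symm.toContinuousLinearEquiv.toContinuousLinearMap ∘L
        fderiv ℝ (fderiv ℝ f) x :=
    (toDual ℝ E).symm.toContinuousLinearEquiv.comp_fderiv
  rw [divergence_eq_sum_inner, hfd,
    laplacian_eq_iteratedFDeriv_stdOrthonormalBasis]
  refine Finset.sum_congr rfl fun i _ ↦ ?_
  rw [real_inner_comm, iteratedFDeriv_two_apply]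
  exact toDual_symm_apply

variable [MeasurableSpace E] [BorelSpace E]

theorem integrable_fderiv_apply (hV : ContDiff ℝ 1 V) (hc : HasCompactSupport V) (v : E) :
    Integrable fun x ↦ fderiv ℝ V x v :=
  ((hV.continuous_fderiv one_ne_zero).clm_apply continuous_const).integrable_of_hasCompactSupport
    (hc.fderiv_apply ℝ v)

theorem integral_fderiv_apply_eq_zero (hV : ContDiff ℝ 1 V) (hc : HasCompactSupport V) (v : E) :
    ∫ x, fderiv ℝ V x v = 0 := by
  have := integral_smul_fderiv_eq_neg_fderiv_smul_of_integrable (μ := volume) (v := v)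
    (f := fun _ ↦ (1 : ℝ)) (g := V) (by simp) (by simpa using integrable_fderiv_apply hV hc v)
    (by simpa using hV.continuous.integrable_of_hasCompactSupport hc) (by simp)
    fun x _ ↦ hV.differentiable one_ne_zero x
  simpa using this

theorem integrable_divergence (hV : ContDiff ℝ 1 V) (hc : HasCompactSupport V) :
    Integrable (divergence V) := by
  simp_rw [funext (divergence_eq_sum_inner V)]
  exact integrable_finsetSum _ fun i _ ↦ (integrable_fderiv_apply hV hc _).const_inner _

theorem integral_divergence_eq_zero (hV : ContDiff ℝ 1 V) (hc : HasCompactSupport V) :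
    ∫ x, divergence V x = 0 := by
  simp_rw [divergence_eq_sum_inner]
  rw [integral_finsetSum _ fun i _ ↦ (integrable_fderiv_apply hV hc _).const_inner _]
  exact Finset.sum_eq_zero fun i _ ↦ by
    simpa [integral_fderiv_apply_eq_zero hV hc] using
      integral_inner (𝕜 := ℝ) (integrable_fderiv_apply hV hc (stdOrthonormalBasis ℝ E i)) _

end Divergence

section BallSupport

variable {E F : Type*} [NormedAddCommGroup E] [NormedAddCommGroup F] {f : E → F} {s : Set E}
  {k : ℕ∞}

theorem tsupport_subset_Iio_iff {X : Type*} [Zero X] {q : ℝ → X} {a : ℝ} :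
    tsupport q ⊆ Iio a ↔ ∃ b < a, ∀ t, b < t → q t = 0 := by
  constructor
  · intro hq
    obtain ⟨b, hb, hba⟩ := exists_Ioc_subset_of_mem_nhds
      ((isClosed_tsupport q).isOpen_compl.mem_nhds fun ha ↦ lt_irrefl a (hq ha)) (exists_lt a)
    refine ⟨b, hb, fun t ht ↦ image_eq_zero_of_notMem_tsupport fun htq ↦ ?_⟩
    exact hba ⟨ht, (hq htq).le⟩ htq
  · rintro ⟨b, hb, hq⟩
    have : tsupport q ⊆ Iic b :=
      closure_minimal (fun t ht ↦ not_lt.1 fun hbt ↦ ht (hq t hbt)) isClosed_Iic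
    exact this.trans fun t ht ↦ lt_of_le_of_lt ht hb

theorem hasCompactSupport_of_tsupport_subset_ball [ProperSpace E] (hf : tsupport f ⊆ ball 0 1) :
    HasCompactSupport f :=
  .of_support_subset_isCompact (isCompact_closedBall 0 1)
    ((subset_tsupport f).trans (hf.trans ball_subset_closedBall))

theorem tsupport_comp_norm_sq_subset {m : ℝ → F} (hm : tsupport m ⊆ Iio 1) :
    tsupport (fun x : E ↦ m (‖x‖ ^ 2)) ⊆ ball 0 1 := by
  intro x hx
  have := hm (tsupport_comp_subset_preimage m (f := fun x : E ↦ ‖x‖ ^ 2) (by fun_prop) hx)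
  simpa using this

variable [NormedSpace ℝ E] [NormedSpace ℝ F]

theorem contDiff_of_tsupport_subset (hs : IsOpen s) (hf : ContDiffOn ℝ k f s)
    (hfs : tsupport f ⊆ s) : ContDiff ℝ k f :=
  contMDiff_iff_contDiff.1 <| contMDiff_of_tsupport fun _ hx ↦
    (hf.contDiffAt (hs.mem_nhds (hfs hx))).contMDiffAt

end BallSupport

section RadialFields

variable {E : Type*} [NormedAddCommGroup E] [InnerProductSpace ℝ E] {m : ℝ → ℝ} {x : E}

theorem fderiv_comp_norm_sq_apply (hm : DifferentiableAt ℝ m (‖x‖ ^ 2)) (v : E) :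
    fderiv ℝ (fun y ↦ m (‖y‖ ^ 2)) x v = 2 * deriv m (‖x‖ ^ 2) * ⟪x, v⟫_ℝ := by
  have hnorm : DifferentiableAt ℝ (fun y : E ↦ ‖y‖ ^ 2) x := differentiableAt_fun_id.norm_sq ℝ
  rw [fderiv_fun_comp x hm hnorm]
  simp only [fderiv_norm_sq_apply, ContinuousLinearMap.comp_smul, smul_apply,
    ContinuousLinearMap.comp_apply, coe_innerSL_apply, fderiv_eq_smul_deriv, smul_eq_mul,
    nsmul_eq_mul, Nat.cast_ofNat]
  ring

variable {V : E → E}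

theorem tsupport_radial_smul_subset (hms : tsupport m ⊆ Iio 1) :
    tsupport (fun y ↦ m (‖y‖ ^ 2) • V y) ⊆ ball 0 1 :=
  (tsupport_smul_subset_left _ _).trans (tsupport_comp_norm_sq_subset hms)

theorem contDiff_radial_smul (hm : ContDiffOn ℝ 1 m (Iio 1)) (hms : tsupport m ⊆ Iio 1)
    (hV : ContDiffOn ℝ 1 V (ball 0 1)) : ContDiff ℝ 1 fun y ↦ m (‖y‖ ^ 2) • V y := by
  have hm' : ContDiff ℝ 1 m := contDiff_of_tsupport_subset (k := 1) isOpen_Iio hm hms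
  exact contDiff_of_tsupport_subset (k := 1) isOpen_ball
    ((hm'.comp (contDiff_norm_sq ℝ)).contDiffOn.smul hV) (tsupport_radial_smul_subset hms)

variable [FiniteDimensional ℝ E]

theorem divergence_radial_smul (hm : DifferentiableAt ℝ m (‖x‖ ^ 2))
    (hV : DifferentiableAt ℝ V x) :
    divergence (fun y ↦ m (‖y‖ ^ 2) • V y) x =
      2 * deriv m (‖x‖ ^ 2) * ⟪x, V x⟫_ℝ + m (‖x‖ ^ 2) * divergence V x := by
  have hnorm : DifferentiableAt ℝ (fun y : E ↦ ‖y‖ ^ 2) x := differentiableAt_fun_id.norm_sq ℝ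
  rw [divergence_smul (f := fun y ↦ m (‖y‖ ^ 2)) (hm.comp x hnorm) hV, fderiv_comp_norm_sq_apply hm]

variable [MeasurableSpace E] [BorelSpace E]

theorem integrableOn_divergence_radial_smul (hm : ContDiffOn ℝ 1 m (Iio 1))
    (hms : tsupport m ⊆ Iio 1) (hV : ContDiffOn ℝ 1 V (ball 0 1)) :
    IntegrableOn (divergence fun y ↦ m (‖y‖ ^ 2) • V y) (ball 0 1) :=
  (integrable_divergence (contDiff_radial_smul hm hms hV)
    (hasCompactSupport_of_tsupport_subset_ball (tsupport_radial_smul_subset hms))).integrableOn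

theorem setIntegral_divergence_radial_smul_eq_zero (hm : ContDiffOn ℝ 1 m (Iio 1))
    (hms : tsupport m ⊆ Iio 1) (hV : ContDiffOn ℝ 1 V (ball 0 1)) :
    ∫ x in ball 0 1, divergence (fun y ↦ m (‖y‖ ^ 2) • V y) x = 0 := by
  have hsupp : tsupport (fun y ↦ m (‖y‖ ^ 2) • V y) ⊆ ball 0 1 := tsupport_radial_smul_subset hms
  rw [setIntegral_eq_integral_of_forall_compl_eq_zero fun x hx ↦ ?_]
  · exact integral_divergence_eq_zero (contDiff_radial_smul hm hms hV)
      (hasCompactSupport_of_tsupport_subset_ball hsupp)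
  · rw [divergence, fderiv_of_notMem_tsupport ℝ fun hx' ↦ hx (hsupp hx'),
      ContinuousLinearMap.toLinearMap_zero, map_zero]

end RadialFields

section Flux

variable {n : ℕ} {h : EuclideanSpace ℝ (Fin n) → ℝ} {q : ℝ → ℝ} {x : EuclideanSpace ℝ (Fin n)}

theorem sum_coord_mul_apply_single (L : EuclideanSpace ℝ (Fin n) →L[ℝ] ℝ)
    (v : EuclideanSpace ℝ (Fin n)) : ∑ i, v i * L (EuclideanSpace.single i 1) = L v := by
  conv_rhs => rw [← (EuclideanSpace.basisFun (Fin n) ℝ).sum_repr v]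
  simp [map_sum]

theorem hyperbolicLaplacian_eq_zero_iff (hx : x ∈ ball 0 1) :
    hyperbolicLaplacian h x = 0 ↔
      (1 - ‖x‖ ^ 2) * Laplacian.laplacian h x + 2 * ((n : ℝ) - 2) * fderiv ℝ h x x = 0 := by
  have hpos : 0 < 1 - ‖x‖ ^ 2 := by nlinarith [norm_nonneg x, mem_ball_zero_iff.1 hx]
  have hfactor : hyperbolicLaplacian h x = (1 - ‖x‖ ^ 2) *
      ((1 - ‖x‖ ^ 2) * Laplacian.laplacian h x + 2 * ((n : ℝ) - 2) * fderiv ℝ h x x) := by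
    rw [hyperbolicLaplacian, sum_coord_mul_apply_single]
    ring
  rw [hfactor, mul_eq_zero_iff_left hpos.ne']

/-- The factor `ψ` for which the field `ψ(|x|²) ∇h` has divergence `q(|x|²) ⟨x, ∇h⟩`. -/
noncomputable def fluxFactor (k : ℤ) (q : ℝ → ℝ) (s : ℝ) : ℝ :=
  (1 - s) ^ (-k) * ∫ t in (1 : ℝ)..s, (1 - t) ^ k * q t / 2

theorem tsupport_fluxFactor_subset (k : ℤ) (hq : tsupport q ⊆ Iio 1) :
    tsupport (fluxFactor k q) ⊆ Iio 1 := by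
  obtain ⟨b, hb, hqb⟩ := tsupport_subset_Iio_iff.1 hq
  refine tsupport_subset_Iio_iff.2 ⟨b, hb, fun s hs ↦ ?_⟩
  have : ∫ t in (1 : ℝ)..s, (1 - t) ^ k * q t / 2 = ∫ _ in (1 : ℝ)..s, (0 : ℝ) := by
    refine intervalIntegral.integral_congr fun t ht ↦ ?_
    simp [hqb t (lt_of_lt_of_le (lt_min hb hs) ht.1)]
  rw [fluxFactor, this]
  simp

theorem hasDerivAt_one_sub_zpow_neg (k : ℤ) {s : ℝ} (hs : s < 1) :
    HasDerivAt (fun t : ℝ ↦ (1 - t) ^ (-k)) (k * (1 - s) ^ (-k - 1)) s :=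
  ((hasDerivAt_zpow (-k) (1 - s) (.inl (sub_pos.2 hs).ne')).comp s
    ((hasDerivAt_id s).const_sub 1)).congr_deriv (by push_cast; ring)

theorem hasDerivAt_fluxFactor (k : ℤ) (hq : Continuous q) (hqs : tsupport q ⊆ Iio 1) {s : ℝ}
    (hs : s < 1) :
    HasDerivAt (fluxFactor k q) (k / (1 - s) * fluxFactor k q s + q s / 2) s := by
  have hs' : 1 - s ≠ 0 := (sub_pos.2 hs).ne'
  have hcont : Continuous fun t ↦ (1 - t) ^ k * q t / 2 := by
    refine ContinuousOn.continuous_of_tsupport_subset (s := Iio 1) (fun t ht ↦ ?_) isOpen_Iio ?_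
    · have := (sub_pos.2 (mem_Iio.1 ht)).ne'
      exact ContinuousAt.continuousWithinAt (by fun_prop (disch := simp [this]))
    · simp_rw [mul_div_assoc]
      exact tsupport_mul_subset_right.trans ((tsupport_mul_subset_left).trans hqs)
  refine ((hasDerivAt_one_sub_zpow_neg k hs).mul
    (hcont.integral_hasStrictDerivAt 1 s).hasDerivAt).congr_deriv ?_
  rw [fluxFactor, zpow_sub_one₀ hs', zpow_neg]
  field_simp

theorem contDiffOn_fluxFactor (k : ℤ) (hq : Continuous q) (hqs : tsupport q ⊆ Iio 1) :
    ContDiffOn ℝ 1 (fluxFactor k q) (Iio 1) := by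
  have hderiv {s : ℝ} (hs : s ∈ Iio 1) := hasDerivAt_fluxFactor k hq hqs hs
  have hcont : ContinuousOn (fluxFactor k q) (Iio 1) := fun s hs ↦
    (hderiv hs).continuousAt.continuousWithinAt
  have hsub {s : ℝ} (hs : s ∈ Iio 1) : 1 - s ≠ 0 := (sub_pos.2 hs).ne'
  refine (contDiffOn_one_iff_derivWithin isOpen_Iio.uniqueDiffOn).2
    ⟨fun s hs ↦ (hderiv hs).differentiableAt.differentiableWithinAt, ?_⟩
  refine ContinuousOn.congr (f := fun s ↦ k / (1 - s) * fluxFactor k q s + q s / 2) ?_ fun s hs ↦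
    (hderiv hs).hasDerivWithinAt.derivWithin (isOpen_Iio.uniqueDiffWithinAt hs)
  exact (((continuousOn_const.div (by fun_prop) fun s hs ↦ hsub hs).mul hcont).add
    (hq.continuousOn.div_const 2))

theorem IsHyperbolicHarmonic.integral_fderiv_apply_self_mul_eq_zero (hh : IsHyperbolicHarmonic h)
    (hq : Continuous q) (hqs : tsupport q ⊆ Iio 1) :
    ∫ x in ball 0 1, q (‖x‖ ^ 2) * fderiv ℝ h x x = 0 := by
  have hψ := contDiffOn_fluxFactor (n - 2) hq hqs
  have hψs := tsupport_fluxFactor_subset (n - 2) hqs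
  have hgrad : ContDiffOn ℝ 1 (gradient h) (ball 0 1) :=
    (toDual ℝ _).symm.contDiff.comp_contDiffOn (hh.1.fderiv_of_isOpen isOpen_ball (by norm_num))
  rw [← setIntegral_divergence_radial_smul_eq_zero hψ hψs hgrad]
  refine setIntegral_congr_fun measurableSet_ball fun x hx ↦ ?_
  have hs : ‖x‖ ^ 2 < 1 := by simpa using hx
  have hpos : 1 - ‖x‖ ^ 2 ≠ 0 := (sub_pos.2 hs).ne'
  have hderiv := hasDerivAt_fluxFactor (n - 2) hq hqs hs
  have hlap := (hyperbolicLaplacian_eq_zero_iff hx).1 (hh.2 x hx)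
  rw [divergence_radial_smul hderiv.differentiableAt
    ((hgrad.contDiffAt (isOpen_ball.mem_nhds hx)).differentiableAt one_ne_zero),
    divergence_gradient, hderiv.deriv, inner_gradient_right, conj_trivial]
  push_cast
  field_simp
  linear_combination -fluxFactor (n - 2) q (‖x‖ ^ 2) * hlap

end Flux

section ParametricIntegral

variable {X : Type*} [TopologicalSpace X] [MeasurableSpace X] [OpensMeasurableSpace X]
  {μ : Measure X}

theorem hasDerivAt_setIntegral_mul_of_isCompact {g : X → ℝ} {N N' : ℝ → X → ℝ} {s K : Set X}
    {U : Set ℝ} {t : ℝ} (hK : IsCompact K) (hs : MeasurableSet s) (hsK : s ⊆ K)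
    (hg : IntegrableOn g s μ) (hU : U ∈ 𝓝 t) (hN : ∀ r ∈ U, ContinuousOn (N r) K)
    (hN' : ContinuousOn (fun p : ℝ × X ↦ N' p.1 p.2) (U ×ˢ K))
    (hderiv : ∀ r ∈ U, ∀ x ∈ s, HasDerivAt (fun r ↦ N r x) (N' r x) r) :
    HasDerivAt (fun r ↦ ∫ x in s, g x * N r x ∂μ) (∫ x in s, g x * N' t x ∂μ) t := by
  obtain ⟨ε, hε, hεU⟩ := Metric.nhds_basis_closedBall.mem_iff.1 hU
  obtain ⟨C, hC⟩ := ((isCompact_closedBall t ε).prod hK).exists_bound_of_continuousOn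
    (hN'.mono (prod_mono_left hεU))
  have ht : t ∈ U := mem_of_mem_nhds hU
  have hmeas {k : X → ℝ} (hk : ContinuousOn k K) : AEStronglyMeasurable k (μ.restrict s) :=
    (hk.mono hsK).aestronglyMeasurable hs
  have hint {k : X → ℝ} (hk : ContinuousOn k K) : IntegrableOn (fun x ↦ g x * k x) s μ := by
    obtain ⟨D, hD⟩ := hK.exists_bound_of_continuousOn hk
    refine hg.mul_bdd (c := D) (hmeas hk) ?_
    filter_upwards [ae_restrict_mem hs] with x hx using hD x (hsK hx)
  have hN't : ContinuousOn (N' t) K :=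
    hN'.comp (Continuous.prodMk_right t).continuousOn fun x hx ↦ ⟨ht, hx⟩
  refine (hasDerivAt_integral_of_dominated_loc_of_deriv_le (F := fun r x ↦ g x * N r x)
    (F' := fun r x ↦ g x * N' r x) (bound := fun x ↦ ‖g x‖ * C) (closedBall_mem_nhds t hε) ?_
    (hint (hN t ht)) (hint hN't).1 ?_ (hg.norm.mul_const C) ?_).2
  · filter_upwards [hU] with r hr using (hint (hN r hr)).1
  · filter_upwards [ae_restrict_mem hs] with x hx r hr
    rw [norm_mul]
    exact mul_le_mul_of_nonneg_left (hC (r, x) ⟨hr, hsK hx⟩) (norm_nonneg _)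
  · filter_upwards [ae_restrict_mem hs] with x hx r hr
    exact (hderiv r (hεU hr) x hx).const_mul (g x)

end ParametricIntegral

section MeanValue

variable {n : ℕ} {h : EuclideanSpace ℝ (Fin n) → ℝ} {m : ℝ → ℝ}

theorem IsHyperbolicHarmonic.integral_fderiv_smul_apply_eq_zero (hh : IsHyperbolicHarmonic h)
    (hm : Continuous m) (hms : tsupport m ⊆ Iio 1) {r : ℝ} (hr : 0 < r) (hr1 : r ≤ 1) :
    ∫ x in ball 0 1, m (‖x‖ ^ 2) * fderiv ℝ h (r • x) x = 0 := by
  have hms' : tsupport (fun s ↦ m (s / r ^ 2)) ⊆ Iio 1 := fun s hs ↦ by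
    have := hms (tsupport_comp_subset_preimage m (f := fun s ↦ s / r ^ 2) (by fun_prop) hs)
    exact ((div_lt_one (by positivity)).1 this).trans_le (pow_le_one₀ hr.le hr1)
  have hflux := hh.integral_fderiv_apply_self_mul_eq_zero
    (hm.comp (continuous_id.div_const (r ^ 2))) hms'
  have hscale : ∫ x in ball 0 1, m (‖r • x‖ ^ 2 / r ^ 2) * fderiv ℝ h (r • x) (r • x) = 0 := by
    rw [Measure.setIntegral_comp_smul_of_pos volume
      (fun y ↦ m (‖y‖ ^ 2 / r ^ 2) * fderiv ℝ h y y) _ hr, smul_unitBall hr.ne',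
      Real.norm_of_nonneg hr.le,
      ← setIntegral_eq_of_subset_of_forall_sdiff_eq_zero measurableSet_ball
        (ball_subset_ball hr1)]
    · exact smul_eq_zero_of_right _ hflux
    · rintro y ⟨-, hy⟩
      have hy1 : ‖y‖ ^ 2 / r ^ 2 ∉ tsupport m := fun hs ↦ hy <| by
        have := (div_lt_one (by positivity)).1 (mem_Iio.1 (hms hs))
        simpa using lt_of_pow_lt_pow_left₀ 2 hr.le this
      rw [image_eq_zero_of_notMem_tsupport hy1, zero_mul]
  have hfactor (x : EuclideanSpace ℝ (Fin n)) :
      m (‖r • x‖ ^ 2 / r ^ 2) * fderiv ℝ h (r • x) (r • x) =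
        r * (m (‖x‖ ^ 2) * fderiv ℝ h (r • x) x) := by
    rw [norm_smul, mul_pow, Real.norm_of_nonneg hr.le, mul_div_cancel_left₀ _ (by positivity),
      map_smul, smul_eq_mul, mul_left_comm]
  simp_rw [hfactor, integral_const_mul] at hscale
  exact (mul_eq_zero_iff_left hr.ne').1 hscale

theorem IsHyperbolicHarmonic.hasDerivAt_integral_mul_comp_smul (hh : IsHyperbolicHarmonic h)
    (hm : Continuous m) {ρ r : ℝ} (hρ : 0 < ρ) (hr : |r| < ρ⁻¹) :
    HasDerivAt (fun r ↦ ∫ x in closedBall 0 ρ, m (‖x‖ ^ 2) * h (r • x))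
      (∫ x in closedBall 0 ρ, m (‖x‖ ^ 2) * fderiv ℝ h (r • x) x) r := by
  have hU : {r : ℝ | |r| < ρ⁻¹} ∈ 𝓝 r := (isOpen_lt continuous_abs continuous_const).mem_nhds hr
  have hmem {r : ℝ} (hr : |r| < ρ⁻¹) {x : EuclideanSpace ℝ (Fin n)} (hx : x ∈ closedBall 0 ρ) :
      r • x ∈ ball 0 1 := by
    rw [mem_ball_zero_iff, norm_smul, Real.norm_eq_abs]
    calc |r| * ‖x‖ ≤ |r| * ρ := by gcongr; simpa using hx
      _ < 1 := by rwa [← lt_div_iff₀ hρ, one_div]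
  have hdiff : DifferentiableOn ℝ h (ball 0 1) := hh.1.differentiableOn two_ne_zero
  have hcont : ContinuousOn (fderiv ℝ h) (ball 0 1) :=
    hh.1.continuousOn_fderiv_of_isOpen isOpen_ball (by norm_num)
  refine hasDerivAt_setIntegral_mul_of_isCompact (g := fun x ↦ m (‖x‖ ^ 2))
    (N := fun r x ↦ h (r • x)) (N' := fun r x ↦ fderiv ℝ h (r • x) x)
    (isCompact_closedBall (0 : EuclideanSpace ℝ (Fin n)) ρ) measurableSet_closedBall
    subset_rfl ?_ hU (fun r hr ↦ ?_) ?_ fun r hr x hx ↦ ?_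
  · exact ContinuousOn.integrableOn_compact (isCompact_closedBall 0 ρ) (by fun_prop)
  · exact hdiff.continuousOn.comp (by fun_prop) fun x hx ↦ hmem hr hx
  · exact ContinuousOn.clm_apply (hcont.comp (f := fun p : ℝ × EuclideanSpace ℝ (Fin n) ↦ p.1 • p.2)
      (by fun_prop) fun p hp ↦ hmem hp.1 hp.2) (by fun_prop)
  · have hsmul : HasDerivAt (fun r : ℝ ↦ r • x) x r := by
      simpa using (hasDerivAt_id r).smul_const x
    exact (hdiff.differentiableAt (isOpen_ball.mem_nhds (hmem hr hx))).hasFDerivAt.comp_hasDerivAt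
      r hsmul

theorem IsHyperbolicHarmonic.integral_radial_mul (hh : IsHyperbolicHarmonic h)
    (hm : Continuous m) (hms : tsupport m ⊆ Iio 1) :
    ∫ x in ball 0 1, m (‖x‖ ^ 2) * h x =
      (∫ x : EuclideanSpace ℝ (Fin n) in ball 0 1, m (‖x‖ ^ 2)) * h 0 := by
  obtain ⟨ρ, ⟨hρ, hρ1⟩, hmρ⟩ := exists_pos_lt_subset_ball one_pos (isClosed_tsupport _)
    (tsupport_comp_norm_sq_subset (E := EuclideanSpace ℝ (Fin n)) hms)
  have hball (k : EuclideanSpace ℝ (Fin n) → ℝ) :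
      ∫ x in ball 0 1, m (‖x‖ ^ 2) * k x = ∫ x in closedBall 0 ρ, m (‖x‖ ^ 2) * k x := by
    refine setIntegral_eq_of_subset_of_forall_sdiff_eq_zero measurableSet_ball
      (closedBall_subset_ball hρ1) fun x hx ↦ ?_
    rw [image_eq_zero_of_notMem_tsupport fun hx' ↦ hx.2 (ball_subset_closedBall (hmρ hx')),
      zero_mul]
  have hderiv (r : ℝ) (hr : r ∈ Icc (0 : ℝ) 1) :=
    hh.hasDerivAt_integral_mul_comp_smul hm hρ
      ((abs_le.2 ⟨by linarith [hr.1], hr.2⟩).trans_lt (one_lt_inv₀ hρ |>.2 hρ1))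
  obtain ⟨r, hr, hslope⟩ := exists_hasDerivAt_eq_slope _ _ zero_lt_one
    (fun r hr ↦ (hderiv r hr).continuousAt.continuousWithinAt)
    fun r hr ↦ hderiv r (Ioo_subset_Icc_self hr)
  rw [← hball, hh.integral_fderiv_smul_apply_eq_zero hm hms hr.1 hr.2.le] at hslope
  simp only [one_smul, zero_smul, ← hball, integral_mul_const] at hslope
  linarith

end MeanValue

section Conformal

variable {E F : Type*} [NormedAddCommGroup E] [InnerProductSpace ℝ E] [NormedAddCommGroup F]
  [NormedSpace ℝ F] {f : E → E} {g : E → F} {x : E}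

theorem fderiv_fderiv_comp_apply (hg : ContDiffAt ℝ 2 g (f x)) (hf : ContDiffAt ℝ 2 f x)
    (v w : E) :
    fderiv ℝ (fderiv ℝ (g ∘ f)) x v w =
      fderiv ℝ (fderiv ℝ g) (f x) (fderiv ℝ f x v) (fderiv ℝ f x w) +
        fderiv ℝ g (f x) (fderiv ℝ (fderiv ℝ f) x v w) := by
  have hchain : fderiv ℝ (g ∘ f) =ᶠ[𝓝 x] fun y ↦ (fderiv ℝ g (f y)).comp (fderiv ℝ f y) := by
    filter_upwards [hf.continuousAt.eventually (hg.eventually (by simp)), hf.eventually (by simp)]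
      with y hgy hfy
    exact fderiv_comp y (hgy.differentiableAt two_ne_zero) (hfy.differentiableAt two_ne_zero)
  have hDg := ((hg.fderiv_right (m := 1) (by norm_num)).differentiableAt one_ne_zero).hasFDerivAt
  have hDf := ((hf.fderiv_right (m := 1) (by norm_num)).differentiableAt one_ne_zero).hasFDerivAt
  have hD := (hDg.comp x (hf.differentiableAt two_ne_zero).hasFDerivAt).clm_comp hDf
  rw [(hD.congr_of_eventuallyEq hchain).fderiv]
  simp [add_comm]

theorem laplacian_comp_of_fderiv_eq_smul [FiniteDimensional ℝ E] {r : ℝ} {A : E ≃ₗᵢ[ℝ] E}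
    (hg : ContDiffAt ℝ 2 g (f x)) (hf : ContDiffAt ℝ 2 f x)
    (hA : fderiv ℝ f x = r • (A : E →L[ℝ] E)) :
    Laplacian.laplacian (g ∘ f) x =
      r ^ 2 • Laplacian.laplacian g (f x) + fderiv ℝ g (f x) (Laplacian.laplacian f x) := by
  rw [laplacian_eq_iteratedFDeriv_stdOrthonormalBasis (g ∘ f),
    laplacian_eq_iteratedFDeriv_stdOrthonormalBasis f,
    laplacian_eq_iteratedFDeriv_orthonormalBasis g ((stdOrthonormalBasis ℝ E).map A)]
  simp [iteratedFDeriv_two_apply, fderiv_fderiv_comp_apply hg hf, hA, Finset.sum_add_distrib,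
    Finset.smul_sum, smul_smul, sq]

end Conformal

section Inversion

open EuclideanGeometry

variable {E : Type*} [NormedAddCommGroup E] [InnerProductSpace ℝ E] {c x : E} {R : ℝ}

theorem reflection_orthogonal_span_singleton_apply (y v : E) :
    (ℝ ∙ y)ᗮ.reflection v = v - (2 * ⟪y, v⟫_ℝ * (‖y‖ ^ 2)⁻¹) • y := by
  rw [Submodule.reflection_orthogonal_apply, Submodule.reflection_singleton_apply, neg_sub,
    two_smul, ← add_smul]
  congr 2
  simp only [Real.ringHom_apply]
  ring

theorem hasFDerivAt_inv_norm_sub_sq (hx : x ≠ c) :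
    HasFDerivAt (fun y ↦ (‖y - c‖ ^ 2)⁻¹)
      (-((‖x - c‖ ^ 2)⁻¹ ^ 2) • (2 : ℝ) • innerSL ℝ (x - c)) x := by
  have hN : ‖x - c‖ ^ 2 ≠ 0 := by simpa [sub_eq_zero] using hx
  have hsq := ((hasFDerivAt_id x).sub_const c).norm_sq
  refine ((hasDerivAt_inv hN).comp_hasFDerivAt x hsq).congr_fderiv ?_
  ext v
  simp

variable [FiniteDimensional ℝ E]

theorem gradient_inner_inversion (hx : x ≠ c) (w : E) :
    gradient (fun y ↦ ⟪w, inversion c R y⟫_ℝ) x = (R ^ 2 * (‖x - c‖ ^ 2)⁻¹) • w -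
      (2 * R ^ 2 * ⟪w, x - c⟫_ℝ * (‖x - c‖ ^ 2)⁻¹ ^ 2) • (x - c) := by
  have hT := (innerSL ℝ w).hasFDerivAt.comp x (hasFDerivAt_inversion (R := R) hx)
  refine HasGradientAt.gradient (hasGradientAt_iff_hasFDerivAt.2 (hT.congr_fderiv ?_))
  ext v
  simp only [dist_eq_norm, ContinuousLinearMap.comp_smulₛₗ, Real.ringHom_apply, smul_apply,
    ContinuousLinearMap.comp_apply, ContinuousLinearEquiv.coe_coe,
    LinearIsometryEquiv.coe_toContinuousLinearEquiv, reflection_orthogonal_span_singleton_apply,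
    inner_sub_left, coe_innerSL_apply, inner_sub_right, smul_eq_mul, inv_pow,
    map_sub, map_smul, sub_apply, toDual_apply_apply]
  ring

theorem divergence_gradient_inner_inversion (hx : x ≠ c) (w : E) :
    divergence (fun y ↦ (R ^ 2 * (‖y - c‖ ^ 2)⁻¹) • w -
        (2 * R ^ 2 * ⟪w, y - c⟫_ℝ * (‖y - c‖ ^ 2)⁻¹ ^ 2) • (y - c)) x =
      -2 * ((finrank ℝ E : ℝ) - 2) * R ^ 2 * (‖x - c‖ ^ 2)⁻¹ ^ 2 * ⟪w, x - c⟫_ℝ := by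
  have hN : ‖x - c‖ ≠ 0 := by simpa [sub_eq_zero] using hx
  have hsub : HasFDerivAt (fun y ↦ y - c) (.id ℝ E) x := (hasFDerivAt_id x).sub_const c
  have hμ := hasFDerivAt_inv_norm_sub_sq hx
  have hinner : HasFDerivAt (fun y ↦ ⟪w, y - c⟫_ℝ) (innerSL ℝ w) x :=
    (innerSL ℝ w).hasFDerivAt.comp x hsub
  have hfirst := hμ.const_mul (R ^ 2)
  have hsecond := (hinner.const_mul (2 * R ^ 2)).fun_mul (hμ.pow 2)
  have hdiv : divergence (fun y ↦ y - c) x = finrank ℝ E := by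
    rw [divergence_sub differentiableAt_fun_id (differentiableAt_const c), divergence_id,
      divergence_const, sub_zero]
  rw [divergence_sub (hfirst.differentiableAt.smul_const w)
      (hsecond.differentiableAt.fun_smul hsub.differentiableAt),
    divergence_smul hfirst.differentiableAt (differentiableAt_const w),
    divergence_smul hsecond.differentiableAt hsub.differentiableAt, divergence_const, hdiv,
    hfirst.fderiv, hsecond.fderiv]
  simp only [smul_apply, add_apply, innerSL_apply_apply, real_inner_self_eq_norm_sq, smul_eq_mul,
    real_inner_comm w (x - c), nsmul_eq_mul, Nat.reduceSub]
  field_simp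
  ring

theorem laplacian_inversion (hx : x ≠ c) :
    Laplacian.laplacian (inversion c R) x =
      (-2 * ((finrank ℝ E : ℝ) - 2) * R ^ 2 * (‖x - c‖ ^ 2)⁻¹ ^ 2) • (x - c) := by
  have hT : ContDiffAt ℝ 2 (inversion c R) x :=
    contDiffAt_const.inversion contDiffAt_const contDiffAt_id hx
  refine ext_inner_left ℝ fun w ↦ ?_
  have hgrad : gradient (fun y ↦ ⟪w, inversion c R y⟫_ℝ) =ᶠ[𝓝 x] fun y ↦
      (R ^ 2 * (‖y - c‖ ^ 2)⁻¹) • w -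
        (2 * R ^ 2 * ⟪w, y - c⟫_ℝ * (‖y - c‖ ^ 2)⁻¹ ^ 2) • (y - c) := by
    filter_upwards [isOpen_ne.mem_nhds hx] with y hy using gradient_inner_inversion hy w
  calc ⟪w, Laplacian.laplacian (inversion c R) x⟫_ℝ
      = divergence (gradient fun y ↦ ⟪w, inversion c R y⟫_ℝ) x := by
        rw [divergence_gradient]
        exact (hT.laplacian_CLM_comp_left (l := innerSL ℝ w)).symm
    _ = _ := by
        rw [divergence, hgrad.fderiv_eq, ← divergence, divergence_gradient_inner_inversion hx,
          inner_smul_right]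

end Inversion

section BallInversion

variable {E : Type*} [NormedAddCommGroup E] {c x : E}

/-- The factor by which `ballInversion c` scales lengths infinitesimally at `x`. -/
noncomputable def ballInversionFactor (c x : E) : ℝ := (‖c‖ ^ 2 - 1) / ‖x - c‖ ^ 2

theorem sq_sqrt_div_dist_eq_ballInversionFactor (hc : 1 < ‖c‖) (x : E) :
    (√(‖c‖ ^ 2 - 1) / dist x c) ^ 2 = ballInversionFactor c x := by
  rw [div_pow, Real.sq_sqrt (by nlinarith), dist_eq_norm, ballInversionFactor]

theorem ballInversionFactor_zero (hc : c ≠ 0) : ballInversionFactor c 0 = 1 - (‖c‖ ^ 2)⁻¹ := by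
  simp [ballInversionFactor, sub_div, hc]

theorem ne_of_mem_ball_of_one_lt_norm (hc : 1 < ‖c‖) (hx : x ∈ ball 0 1) : x ≠ c := by
  rintro rfl
  exact (mem_ball_zero_iff.1 hx).not_gt hc

theorem ballInversionFactor_pos (hc : 1 < ‖c‖) (hx : x ∈ ball 0 1) :
    0 < ballInversionFactor c x := by
  have := norm_pos_iff.2 (sub_ne_zero.2 (ne_of_mem_ball_of_one_lt_norm hc hx))
  exact div_pos (by nlinarith) (by positivity)

variable [InnerProductSpace ℝ E]

/-- The inversion in the sphere centred at `c` that is orthogonal to the unit sphere. For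
`1 < ‖c‖` it is a hyperbolic reflection of the unit ball. -/
noncomputable def ballInversion (c : E) : E → E :=
  EuclideanGeometry.inversion c √(‖c‖ ^ 2 - 1)

theorem ballInversion_apply (hc : 1 < ‖c‖) (x : E) :
    ballInversion c x = ballInversionFactor c x • (x - c) + c := by
  rw [ballInversion, EuclideanGeometry.inversion, sq_sqrt_div_dist_eq_ballInversionFactor hc]
  rfl

theorem ballInversion_zero (hc : 1 < ‖c‖) : ballInversion c 0 = (‖c‖ ^ 2)⁻¹ • c := by
  rw [ballInversion_apply hc, ballInversionFactor_zero (norm_pos_iff.1 (by linarith))]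
  module

theorem one_sub_norm_sq_ballInversion (hc : 1 < ‖c‖) (hx : x ≠ c) :
    1 - ‖ballInversion c x‖ ^ 2 = ballInversionFactor c x * (1 - ‖x‖ ^ 2) := by
  have hN : ‖x - c‖ ≠ 0 := by simpa [sub_eq_zero] using hx
  have hx2 : ‖x‖ ^ 2 = ‖x - c‖ ^ 2 + 2 * ⟪x - c, c⟫_ℝ + ‖c‖ ^ 2 := by
    rw [← norm_add_sq_real, sub_add_cancel]
  rw [ballInversion_apply hc, norm_add_sq_real, norm_smul, real_inner_smul_left, hx2, mul_pow,
    Real.norm_eq_abs, sq_abs, ballInversionFactor]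
  field_simp
  ring

theorem mapsTo_ballInversion (hc : 1 < ‖c‖) : MapsTo (ballInversion c) (ball 0 1) (ball 0 1) := by
  intro x hx
  have hfac := mul_pos (ballInversionFactor_pos hc hx)
    (sub_pos.2 ((sq_lt_one_iff₀ (norm_nonneg x)).2 (mem_ball_zero_iff.1 hx)))
  rw [← one_sub_norm_sq_ballInversion hc (ne_of_mem_ball_of_one_lt_norm hc hx), sub_pos,
    sq_lt_one_iff₀ (norm_nonneg _)] at hfac
  exact mem_ball_zero_iff.2 hfac

theorem ballInversion_involutive (hc : 1 < ‖c‖) : Function.Involutive (ballInversion c) :=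
  EuclideanGeometry.inversion_involutive c (Real.sqrt_ne_zero'.2 (by nlinarith))

theorem image_ballInversion_ball (hc : 1 < ‖c‖) : ballInversion c '' ball 0 1 = ball 0 1 :=
  (mapsTo_ballInversion hc).image_subset.antisymm fun x hx ↦
    ⟨ballInversion c x, mapsTo_ballInversion hc hx, ballInversion_involutive hc x⟩

theorem contDiffOn_ballInversion {k : ℕ∞} (hc : 1 < ‖c‖) :
    ContDiffOn ℝ k (ballInversion c) (ball 0 1) :=
  contDiffOn_const.inversion contDiffOn_const contDiffOn_id
    fun _ hx ↦ ne_of_mem_ball_of_one_lt_norm hc hx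

theorem hasFDerivAt_ballInversion (hc : 1 < ‖c‖) (hx : x ≠ c) :
    HasFDerivAt (ballInversion c)
      (ballInversionFactor c x • ((ℝ ∙ (x - c))ᗮ.reflection : E →L[ℝ] E)) x := by
  rw [← sq_sqrt_div_dist_eq_ballInversionFactor hc]
  exact EuclideanGeometry.hasFDerivAt_inversion hx

theorem reflection_eq_ballInversion_add (hc : 1 < ‖c‖) (hx : x ≠ c) :
    (ℝ ∙ (x - c))ᗮ.reflection x =
      ballInversion c x + ((1 - ‖x‖ ^ 2) / ‖x - c‖ ^ 2) • (x - c) := by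
  have hN : ‖x - c‖ ≠ 0 := by simpa [sub_eq_zero] using hx
  have hcoef : ballInversionFactor c x + (1 - ‖x‖ ^ 2) / ‖x - c‖ ^ 2 =
      1 - 2 * ⟪x - c, x⟫_ℝ * (‖x - c‖ ^ 2)⁻¹ := by
    rw [ballInversionFactor, inner_sub_left, real_inner_self_eq_norm_sq, real_inner_comm]
    field_simp
    rw [norm_sub_sq_real]
    ring
  rw [reflection_orthogonal_span_singleton_apply, ballInversion_apply hc]
  linear_combination (norm := module) -hcoef • (x - c)

variable [FiniteDimensional ℝ E] [MeasurableSpace E] [BorelSpace E]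

theorem setIntegral_ball_eq_setIntegral_comp_ballInversion (hc : 1 < ‖c‖) (F : E → ℝ) :
    ∫ y in ball 0 1, F y =
      ∫ x in ball 0 1, ballInversionFactor c x ^ finrank ℝ E * F (ballInversion c x) := by
  conv_lhs => rw [← image_ballInversion_ball hc]
  rw [integral_image_eq_integral_abs_det_fderiv_smul volume measurableSet_ball
    (fun x hx ↦ (hasFDerivAt_ballInversion hc
      (ne_of_mem_ball_of_one_lt_norm hc hx)).hasFDerivWithinAt)
    (ballInversion_involutive hc).injective.injOn]
  refine setIntegral_congr_fun measurableSet_ball fun x hx ↦ ?_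
  have hdet : ((ℝ ∙ (x - c))ᗮ.reflection : E →L[ℝ] E).toLinearMap.normDet = 1 :=
    LinearIsometry.normDet_eq_one (ℝ ∙ (x - c))ᗮ.reflection.toLinearIsometry
  rw [← Real.norm_eq_abs, ContinuousLinearMap.det, ← LinearMap.normDet_eq_norm_det,
    ContinuousLinearMap.toLinearMap_smul, LinearMap.normDet_smul,
    Real.norm_of_nonneg (ballInversionFactor_pos hc hx).le, hdet, mul_one, smul_eq_mul]

end BallInversion

section HarmonicInversion

variable {n : ℕ} {h : EuclideanSpace ℝ (Fin n) → ℝ} {c x : EuclideanSpace ℝ (Fin n)}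

theorem laplacian_comp_ballInversion (hc : 1 < ‖c‖) (hx : x ≠ c)
    (hh : ContDiffAt ℝ 2 h (ballInversion c x)) :
    Laplacian.laplacian (h ∘ ballInversion c) x =
      ballInversionFactor c x ^ 2 * Laplacian.laplacian h (ballInversion c x) -
        2 * ((n : ℝ) - 2) * (ballInversionFactor c x / ‖x - c‖ ^ 2) *
          fderiv ℝ h (ballInversion c x) (x - c) := by
  have hT : ContDiffAt ℝ 2 (ballInversion c) x :=
    contDiffAt_const.inversion contDiffAt_const contDiffAt_id hx
  rw [laplacian_comp_of_fderiv_eq_smul hh hT (hasFDerivAt_ballInversion hc hx).fderiv,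
    ballInversion, laplacian_inversion hx, map_smul, Real.sq_sqrt (by nlinarith),
    finrank_euclideanSpace_fin, ballInversionFactor, smul_eq_mul, smul_eq_mul]
  ring

theorem IsHyperbolicHarmonic.comp_ballInversion (hh : IsHyperbolicHarmonic h) (hc : 1 < ‖c‖) :
    IsHyperbolicHarmonic (h ∘ ballInversion c) := by
  refine ⟨hh.1.comp (contDiffOn_ballInversion (k := 2) hc) (mapsTo_ballInversion hc),
    fun x hx ↦ ?_⟩
  have hxc := ne_of_mem_ball_of_one_lt_norm hc hx
  have hz := mapsTo_ballInversion hc hx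
  have hhz := hh.1.contDiffAt (isOpen_ball.mem_nhds hz)
  have hharm := (hyperbolicLaplacian_eq_zero_iff hz).1 (hh.2 _ hz)
  rw [hyperbolicLaplacian_eq_zero_iff hx, laplacian_comp_ballInversion hc hxc hhz,
    ((hhz.differentiableAt two_ne_zero).hasFDerivAt.comp x
      (hasFDerivAt_ballInversion hc hxc)).fderiv]
  have hrefl := congrArg (fderiv ℝ h (ballInversion c x)) (reflection_eq_ballInversion_add hc hxc)
  rw [one_sub_norm_sq_ballInversion hc hxc] at hharm
  simp only [map_add, map_smul, smul_eq_mul] at hrefl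
  simp only [ContinuousLinearMap.comp_smulₛₗ, Real.ringHom_apply, smul_apply,
    ContinuousLinearMap.comp_apply, ContinuousLinearEquiv.coe_coe,
    LinearIsometryEquiv.coe_toContinuousLinearEquiv, hrefl, smul_eq_mul]
  linear_combination ballInversionFactor c x * hharm

end HarmonicInversion

section MeanValueAtPoint

variable {n : ℕ} {h : EuclideanSpace ℝ (Fin n) → ℝ} {m : ℝ → ℝ} {c : EuclideanSpace ℝ (Fin n)}

theorem IsHyperbolicHarmonic.integral_mul_ballInversionFactor (hh : IsHyperbolicHarmonic h)
    (hm : Continuous m) (hms : tsupport m ⊆ Iio 1) (hc : 1 < ‖c‖) :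
    ∫ y in ball 0 1, h y * (ballInversionFactor c y ^ n *
        m (1 - ballInversionFactor c y * (1 - ‖y‖ ^ 2))) =
      (∫ x : EuclideanSpace ℝ (Fin n) in ball 0 1, m (‖x‖ ^ 2)) * h ((‖c‖ ^ 2)⁻¹ • c) := by
  have hmean := (hh.comp_ballInversion hc).integral_radial_mul hm hms
  rw [Function.comp_apply, ballInversion_zero hc,
    setIntegral_ball_eq_setIntegral_comp_ballInversion hc] at hmean
  rw [← hmean]
  refine setIntegral_congr_fun measurableSet_ball fun y hy ↦ ?_
  have hnorm := one_sub_norm_sq_ballInversion hc (ne_of_mem_ball_of_one_lt_norm hc hy)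
  simp only [Function.comp_apply, ballInversion_involutive hc y, finrank_euclideanSpace_fin,
    ← hnorm, sub_sub_cancel]
  ring

end MeanValueAtPoint

section MovingFactor

variable {E : Type*} [NormedAddCommGroup E] [InnerProductSpace ℝ E] {e y : E} {t : ℝ}

/-- The factor `ballInversionFactor (t⁻¹ • e)`, for a unit vector `e`, in a form that is smooth in
`t` up to `t = 0`. -/
noncomputable def movingFactor (e : E) (t : ℝ) (y : E) : ℝ := (1 - t ^ 2) / ‖t • y - e‖ ^ 2

/-- The derivative of `movingFactor e t y` in `t`. -/
noncomputable def movingFactorDeriv (e : E) (t : ℝ) (y : E) : ℝ :=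
  (-(2 * t) * ‖t • y - e‖ ^ 2 - (1 - t ^ 2) * (2 * ⟪t • y - e, y⟫_ℝ)) / (‖t • y - e‖ ^ 2) ^ 2

theorem norm_smul_sub_sq_ne_zero (he : ‖e‖ = 1) (ht : t ∈ Ioo (-1) 1) (hy : y ∈ closedBall 0 1) :
    ‖t • y - e‖ ^ 2 ≠ 0 := by
  refine pow_ne_zero 2 (norm_ne_zero_iff.2 (sub_ne_zero.2 fun hte ↦ ?_))
  have hlt : ‖t • y‖ < 1 := by
    rw [norm_smul, Real.norm_eq_abs]
    exact mul_lt_one_of_nonneg_of_lt_one_left (abs_nonneg t) (abs_lt.2 ht)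
      (mem_closedBall_zero_iff.1 hy)
  exact hlt.ne (hte ▸ he)

theorem ballInversionFactor_inv_smul (he : ‖e‖ = 1) (ht : t ≠ 0) (y : E) :
    ballInversionFactor (t⁻¹ • e) y = movingFactor e t y := by
  have hsub : y - t⁻¹ • e = t⁻¹ • (t • y - e) := by
    rw [smul_sub, inv_smul_smul₀ ht]
  rw [ballInversionFactor, hsub, norm_smul, norm_smul, he, movingFactor, mul_pow, mul_pow,
    Real.norm_eq_abs, sq_abs, one_pow]
  field_simp

theorem movingFactor_zero (he : ‖e‖ = 1) (y : E) : movingFactor e 0 y = 1 := by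
  simp [movingFactor, he]

theorem movingFactorDeriv_zero (he : ‖e‖ = 1) (y : E) :
    movingFactorDeriv e 0 y = 2 * ⟪e, y⟫_ℝ := by
  simp [movingFactorDeriv, he, inner_neg_left]

theorem hasDerivAt_movingFactor (hty : ‖t • y - e‖ ^ 2 ≠ 0) :
    HasDerivAt (fun t ↦ movingFactor e t y) (movingFactorDeriv e t y) t := by
  have hline : HasDerivAt (fun t : ℝ ↦ t • y - e) y t := by
    simpa using ((hasDerivAt_id t).smul_const y).sub_const e
  have hnum : HasDerivAt (fun t : ℝ ↦ 1 - t ^ 2) (-(2 * t)) t := by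
    simpa using (hasDerivAt_pow 2 t).const_sub 1
  exact hnum.fun_div hline.norm_sq hty

theorem hasDerivAt_movingFactor_pow_mul {m : ℝ → ℝ} (hm : Differentiable ℝ m) (n : ℕ)
    (hty : ‖t • y - e‖ ^ 2 ≠ 0) :
    HasDerivAt (fun t ↦ movingFactor e t y ^ n * m (1 - movingFactor e t y * (1 - ‖y‖ ^ 2)))
      (movingFactorDeriv e t y * (n * movingFactor e t y ^ (n - 1) *
          m (1 - movingFactor e t y * (1 - ‖y‖ ^ 2)) -
        movingFactor e t y ^ n * (1 - ‖y‖ ^ 2) *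
          deriv m (1 - movingFactor e t y * (1 - ‖y‖ ^ 2)))) t := by
  have hfac := hasDerivAt_movingFactor hty
  refine ((hfac.fun_pow n).fun_mul ((hm _).hasDerivAt.comp t
    ((hfac.mul_const (1 - ‖y‖ ^ 2)).const_sub 1))).congr_deriv ?_
  simp only [Function.comp_apply]
  ring

theorem continuousOn_movingFactor (he : ‖e‖ = 1) :
    ContinuousOn (fun p : ℝ × E ↦ movingFactor e p.1 p.2) (Ioo (-1) 1 ×ˢ closedBall 0 1) :=
  ContinuousOn.div (by fun_prop) (by fun_prop) fun _ hp ↦ norm_smul_sub_sq_ne_zero he hp.1 hp.2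

theorem continuousOn_movingFactorDeriv (he : ‖e‖ = 1) :
    ContinuousOn (fun p : ℝ × E ↦ movingFactorDeriv e p.1 p.2) (Ioo (-1) 1 ×ˢ closedBall 0 1) :=
  ContinuousOn.div (by fun_prop) (by fun_prop) fun _ hp ↦
    pow_ne_zero 2 (norm_smul_sub_sq_ne_zero he hp.1 hp.2)

end MovingFactor

section GradientFormula

variable {n : ℕ} {h : EuclideanSpace ℝ (Fin n) → ℝ} {m : ℝ → ℝ} {e : EuclideanSpace ℝ (Fin n)}

theorem hasDerivAt_integral_mul_movingFactor (hg : IntegrableOn h (ball 0 1))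
    (hm : ContDiff ℝ 1 m) (he : ‖e‖ = 1) :
    HasDerivAt (fun t ↦ ∫ y in ball 0 1, h y * (movingFactor e t y ^ n *
        m (1 - movingFactor e t y * (1 - ‖y‖ ^ 2))))
      (∫ x in ball 0 1, h x * (2 * ⟪e, x⟫_ℝ *
        (n * m (‖x‖ ^ 2) - (1 - ‖x‖ ^ 2) * deriv m (‖x‖ ^ 2)))) 0 := by
  have hm' : Continuous (deriv m) := hm.continuous_deriv_one
  have hfac := continuousOn_movingFactor he
  have hfac' := continuousOn_movingFactorDeriv he
  have hkernel := hasDerivAt_setIntegral_mul_of_isCompact (μ := volume)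
    (g := h) (U := Ioo (-1) 1) (t := 0)
    (N := fun t y ↦ movingFactor e t y ^ n * m (1 - movingFactor e t y * (1 - ‖y‖ ^ 2)))
    (N' := fun t y ↦ movingFactorDeriv e t y * (n * movingFactor e t y ^ (n - 1) *
          m (1 - movingFactor e t y * (1 - ‖y‖ ^ 2)) -
        movingFactor e t y ^ n * (1 - ‖y‖ ^ 2) *
          deriv m (1 - movingFactor e t y * (1 - ‖y‖ ^ 2))))
    (isCompact_closedBall 0 1) measurableSet_ball ball_subset_closedBall hg
    (Ioo_mem_nhds (by simp) (by simp))
    (fun t ht ↦ ?_) ?_ fun t ht y hy ↦ hasDerivAt_movingFactor_pow_mul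
      (hm.differentiable one_ne_zero) n (norm_smul_sub_sq_ne_zero he ht (ball_subset_closedBall hy))
  · simpa [movingFactor_zero he, movingFactorDeriv_zero he] using hkernel
  · have hfact : ContinuousOn (movingFactor e t) (closedBall 0 1) :=
      hfac.comp (Continuous.prodMk_right t).continuousOn fun y hy ↦ ⟨ht, hy⟩
    exact (hfact.pow n).mul (hm.continuous.comp_continuousOn (by fun_prop))
  · have harg : ContinuousOn (fun p : ℝ × EuclideanSpace ℝ (Fin n) ↦
        1 - movingFactor e p.1 p.2 * (1 - ‖p.2‖ ^ 2)) (Ioo (-1) 1 ×ˢ closedBall 0 1) := by fun_prop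
    have hmarg := hm.continuous.comp_continuousOn harg
    have hmarg' := hm'.comp_continuousOn harg
    exact hfac'.mul ((((hfac.pow _).const_mul _).mul hmarg).sub
      (((hfac.pow _).mul (by fun_prop)).mul hmarg'))

/-- The weight paired with `2 h(x) ⟨e, x⟩` in the formula for the gradient of `h` at the origin,
when `m` is the weight paired with `h` in the mean value property in dimension `N`. -/
noncomputable def dipoleWeight (N : ℕ) (m : ℝ → ℝ) (s : ℝ) : ℝ := N * m s - (1 - s) * deriv m s

theorem IsHyperbolicHarmonic.fderiv_zero_apply_mul_integral (hh : IsHyperbolicHarmonic h)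
    (hint : IntegrableOn h (ball 0 1)) (hm : ContDiff ℝ 1 m) (hms : tsupport m ⊆ Iio 1)
    (he : ‖e‖ = 1) :
    (∫ x : EuclideanSpace ℝ (Fin n) in ball 0 1, m (‖x‖ ^ 2)) * fderiv ℝ h 0 e =
      ∫ x in ball 0 1, h x * (2 * ⟪e, x⟫_ℝ * dipoleWeight n m (‖x‖ ^ 2)) := by
  have hmean : (fun t : ℝ ↦ (∫ x : EuclideanSpace ℝ (Fin n) in ball 0 1, m (‖x‖ ^ 2)) *
      h (t • e)) =ᶠ[𝓝 0] fun t ↦ ∫ y in ball 0 1, h y * (movingFactor e t y ^ n *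
        m (1 - movingFactor e t y * (1 - ‖y‖ ^ 2))) := by
    filter_upwards [Ioo_mem_nhds neg_one_lt_zero one_pos] with t ht
    rcases eq_or_ne t 0 with rfl | ht0
    · simp only [movingFactor_zero he, zero_smul, ← hh.integral_radial_mul hm.continuous hms]
      simp [mul_comm]
    · have hc : 1 < ‖t⁻¹ • e‖ := by
        rw [norm_smul, he, mul_one, norm_inv, Real.norm_eq_abs]
        exact (one_lt_inv₀ (abs_pos.2 ht0)).2 (abs_lt.2 ht)
      have hcenter : (‖t⁻¹ • e‖ ^ 2)⁻¹ • t⁻¹ • e = t • e := by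
        rw [norm_smul, he, mul_one, Real.norm_eq_abs, sq_abs, smul_smul]
        congr 1
        field_simp
      have := hh.integral_mul_ballInversionFactor hm.continuous hms hc
      simp only [ballInversionFactor_inv_smul he ht0, hcenter] at this
      exact this.symm
  have hline : HasDerivAt (fun t : ℝ ↦ t • e) e 0 := by
    simpa using (hasDerivAt_id (0 : ℝ)).smul_const e
  have hh0 : HasFDerivAt h (fderiv ℝ h 0) ((0 : ℝ) • e) := by
    rw [zero_smul]
    exact ((hh.1.contDiffAt (isOpen_ball.mem_nhds (mem_ball_self one_pos))).differentiableAt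
      two_ne_zero).hasFDerivAt
  exact ((hh0.comp_hasDerivAt 0 hline).const_mul _).unique
    ((hasDerivAt_integral_mul_movingFactor hint hm he).congr_of_eventuallyEq hmean)

end GradientFormula

section Profile

variable {t u : ℝ}

theorem hasDerivAt_mul_abs_self (u : ℝ) : HasDerivAt (fun v : ℝ ↦ v * |v|) (2 * |u|) u := by
  rcases eq_or_ne u 0 with rfl | hu
  · rw [hasDerivAt_iff_tendsto_slope_zero]
    have habs : Tendsto (fun v : ℝ ↦ |v|) (𝓝[≠] 0) (𝓝 (2 * |0|)) := by
      simpa using (continuous_abs.tendsto (0 : ℝ)).mono_left nhdsWithin_le_nhds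
    refine habs.congr' ?_
    filter_upwards [self_mem_nhdsWithin] with v hv
    simp [inv_mul_cancel_left₀ (show v ≠ 0 from hv)]
  · refine ((hasDerivAt_id u).mul (hasDerivAt_abs hu)).congr_deriv ?_
    rw [id, self_mul_sign]
    ring

/-- The average of `|u - t|` and `|u + t|`, minus its mean over `u ∈ [-1, 1]` when `|t| ≤ 1`. -/
noncomputable def absProfile (t u : ℝ) : ℝ := (|u - t| + |u + t| - (1 + t ^ 2)) / 2

/-- The antiderivative of `absProfile t` that is odd; it also vanishes at `±1` when `|t| ≤ 1`. -/
noncomputable def absProfileIntegral (t u : ℝ) : ℝ :=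
  ((u - t) * |u - t| + (u + t) * |u + t|) / 4 - (1 + t ^ 2) / 2 * u

/-- The odd solution `G` of `(1 - u²) G' - 2 u G = absProfile t` on `(-1, 1)`. -/
noncomputable def profileSolution (t u : ℝ) : ℝ := absProfileIntegral t u / (1 - u ^ 2)

theorem hasDerivAt_absProfileIntegral (t u : ℝ) :
    HasDerivAt (absProfileIntegral t) (absProfile t u) u := by
  have hsub := (hasDerivAt_mul_abs_self (u - t)).comp u ((hasDerivAt_id u).sub_const t)
  have hadd := (hasDerivAt_mul_abs_self (u + t)).comp u ((hasDerivAt_id u).add_const t)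
  refine (((hsub.add hadd).div_const 4).sub
    ((hasDerivAt_id u).const_mul ((1 + t ^ 2) / 2))).congr_deriv ?_
  rw [absProfile]
  ring

theorem hasDerivAt_profileSolution (t : ℝ) (hu : |u| < 1) :
    HasDerivAt (profileSolution t)
      ((absProfile t u + 2 * u * profileSolution t u) / (1 - u ^ 2)) u := by
  have hu2 : 1 - u ^ 2 ≠ 0 := (sub_pos.2 ((sq_lt_one_iff_abs_lt_one u).2 hu)).ne'
  refine ((hasDerivAt_absProfileIntegral t u).div
    (((hasDerivAt_id u).pow 2).const_sub 1) hu2).congr_deriv ?_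
  simp only [profileSolution, id, Pi.pow_apply]
  field_simp
  ring

theorem contDiffOn_profileSolution (t : ℝ) : ContDiffOn ℝ 1 (profileSolution t) (Ioo (-1) 1) := by
  have hderiv : deriv (absProfileIntegral t) = absProfile t :=
    funext fun u ↦ (hasDerivAt_absProfileIntegral t u).deriv
  have hcont : Continuous (absProfile t) := by unfold absProfile; fun_prop
  have hF : ContDiff ℝ 1 (absProfileIntegral t) := contDiff_one_iff_deriv.2
    ⟨fun u ↦ (hasDerivAt_absProfileIntegral t u).differentiableAt, hderiv ▸ hcont⟩
  refine hF.contDiffOn.div (by fun_prop) fun u hu ↦ ?_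
  exact (sub_pos.2 ((sq_lt_one_iff_abs_lt_one u).2 (abs_lt.2 hu))).ne'

theorem absProfile_neg_left : absProfile (-t) u = absProfile t u := by
  simp only [absProfile, sub_neg_eq_add, ← sub_eq_add_neg, neg_sq, add_comm]

theorem absProfile_neg_right : absProfile t (-u) = absProfile t u := by
  rw [absProfile, absProfile, ← abs_neg (-u - t), ← abs_neg (-u + t)]
  ring_nf

theorem profileSolution_neg_left : profileSolution (-t) u = profileSolution t u := by
  simp only [profileSolution, absProfileIntegral, sub_neg_eq_add, ← sub_eq_add_neg, neg_sq,
    add_comm]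

theorem profileSolution_neg_right : profileSolution t (-u) = -profileSolution t u := by
  rw [profileSolution, profileSolution, absProfileIntegral, absProfileIntegral,
    ← abs_neg (-u - t), ← abs_neg (-u + t)]
  ring_nf

theorem mul_profileSolution_nonpos (ht : |t| < 1) (hu : |u| < 1) : u * profileSolution t u ≤ 0 := by
  wlog ht0 : 0 ≤ t generalizing t
  · simpa [profileSolution_neg_left] using this (t := -t) (by simpa using ht) (by linarith)
  wlog hu0 : 0 ≤ u generalizing u
  · simpa [profileSolution_neg_right] using this (u := -u) (by simpa using hu) (by linarith)
  rw [abs_of_nonneg ht0] at ht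
  rw [abs_of_nonneg hu0] at hu
  refine mul_nonpos_of_nonneg_of_nonpos hu0 (div_nonpos_of_nonpos_of_nonneg ?_ (by nlinarith))
  rw [absProfileIntegral, abs_of_nonneg (add_nonneg hu0 ht0)]
  rcases le_total u t with hut | htu
  · rw [abs_of_nonpos (sub_nonpos.2 hut)]
    nlinarith [mul_nonneg (sq_nonneg (1 - t)) hu0]
  · rw [abs_of_nonneg (sub_nonneg.2 htu)]
    nlinarith [mul_nonneg (sub_nonneg.2 hu.le) (show 0 ≤ u - t ^ 2 by nlinarith)]

theorem absProfile_add_mul_profileSolution_nonpos (ht : |t| < 1) (hu : |u| < 1) :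
    absProfile t u + 2 * u * profileSolution t u ≤ 0 := by
  wlog ht0 : 0 ≤ t generalizing t
  · simpa [profileSolution_neg_left, absProfile_neg_left] using
      this (t := -t) (by simpa using ht) (by linarith)
  wlog hu0 : 0 ≤ u generalizing u
  · simpa [profileSolution_neg_right, absProfile_neg_right] using
      this (u := -u) (by simpa using hu) (by linarith)
  rw [abs_of_nonneg ht0] at ht
  rw [abs_of_nonneg hu0] at hu
  have hu2 : 0 < 1 - u ^ 2 := by nlinarith
  rw [profileSolution, ← mul_div_assoc, ← le_neg_iff_add_nonpos_right, ← neg_div,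
    le_div_iff₀ hu2, absProfile, absProfileIntegral, abs_of_nonneg (add_nonneg hu0 ht0)]
  rcases le_total u t with hut | htu
  · rw [abs_of_nonpos (sub_nonpos.2 hut)]
    nlinarith [mul_nonneg (sq_nonneg (1 - t)) (sq_nonneg u), sq_nonneg (1 - t)]
  · rw [abs_of_nonneg (sub_nonneg.2 htu)]
    nlinarith [mul_nonneg (sq_nonneg (1 - u)) (show 0 ≤ 1 + t ^ 2 by positivity)]

end Profile

section TangentialFields

variable {E : Type*} [NormedAddCommGroup E] [InnerProductSpace ℝ E] {G : ℝ → ℝ} {e x : E}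

/-- The field `G(⟨e, x⟩) (|x|² e - ⟨e, x⟩ x)`, tangent to the spheres centred at the origin. -/
def tangentialField (e : E) (G : ℝ → ℝ) (x : E) : E :=
  (‖x‖ ^ 2 * G ⟪e, x⟫_ℝ) • e - (⟪e, x⟫_ℝ * G ⟪e, x⟫_ℝ) • x

theorem inner_tangentialField (e : E) (G : ℝ → ℝ) (x : E) : ⟪x, tangentialField e G x⟫_ℝ = 0 := by
  rw [tangentialField, inner_sub_right, inner_smul_right, inner_smul_right,
    real_inner_self_eq_norm_sq, real_inner_comm x e]
  ring

theorem contDiffOn_tangentialField (he : ‖e‖ = 1) (hG : ContDiffOn ℝ 1 G (Ioo (-1) 1)) :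
    ContDiffOn ℝ 1 (tangentialField e G) (ball 0 1) := by
  have hinner : ContDiff ℝ 1 fun x : E ↦ ⟪e, x⟫_ℝ := (innerSL ℝ e).contDiff
  have hmaps : MapsTo (fun x : E ↦ ⟪e, x⟫_ℝ) (ball 0 1) (Ioo (-1) 1) := fun x hx ↦
    abs_lt.1 ((abs_real_inner_le_norm e x).trans_lt (by simpa [he] using hx))
  have hGe := hG.comp hinner.contDiffOn hmaps
  exact (((contDiff_norm_sq ℝ).contDiffOn.mul hGe).smul contDiffOn_const).sub
    ((hinner.contDiffOn.mul hGe).smul contDiffOn_id)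

variable [FiniteDimensional ℝ E]

theorem divergence_tangentialField (hG : DifferentiableAt ℝ G ⟪e, x⟫_ℝ) :
    divergence (tangentialField e G) x =
      (‖x‖ ^ 2 * ‖e‖ ^ 2 - ⟪e, x⟫_ℝ ^ 2) * deriv G ⟪e, x⟫_ℝ
        - (finrank ℝ E - 1) * (⟪e, x⟫_ℝ * G ⟪e, x⟫_ℝ) := by
  have hinner : HasFDerivAt (fun y : E ↦ ⟪e, y⟫_ℝ) (innerSL ℝ e) x := (innerSL ℝ e).hasFDerivAt
  have hGe : HasFDerivAt (fun y ↦ G ⟪e, y⟫_ℝ) (deriv G ⟪e, x⟫_ℝ • innerSL ℝ e) x :=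
    hG.hasDerivAt.comp_hasFDerivAt x hinner
  have hnorm := ((hasStrictFDerivAt_norm_sq x).hasFDerivAt).fun_mul hGe
  have hmul := hinner.fun_mul hGe
  unfold tangentialField
  rw [divergence_sub (hnorm.differentiableAt.smul_const e)
      (hmul.differentiableAt.fun_smul differentiableAt_fun_id),
    divergence_smul hnorm.differentiableAt (differentiableAt_const e),
    divergence_smul hmul.differentiableAt differentiableAt_fun_id,
    divergence_const, divergence_id, hnorm.fderiv, hmul.fderiv]
  simp only [FunLike.coe_add, FunLike.coe_smul, Pi.add_apply, Pi.smul_apply, innerSL_apply_apply,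
    smul_eq_mul, two_nsmul, real_inner_self_eq_norm_sq, real_inner_comm e x]
  ring

end TangentialFields

section ProfileInequality

variable {E : Type*} [NormedAddCommGroup E] [InnerProductSpace ℝ E] [FiniteDimensional ℝ E]
  {e x : E} {t : ℝ} {w : ℝ → ℝ}

theorem absProfile_inner_le_divergence_tangentialField (hE : 3 ≤ finrank ℝ E) (he : ‖e‖ = 1)
    (ht : |t| < 1) (hx : x ∈ ball 0 1) :
    absProfile t ⟪e, x⟫_ℝ ≤ divergence (tangentialField e (profileSolution t)) x := by
  have hu : |⟪e, x⟫_ℝ| < 1 := (abs_real_inner_le_norm e x).trans_lt (by simpa [he] using hx)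
  have hderiv := hasDerivAt_profileSolution t hu
  rw [divergence_tangentialField hderiv.differentiableAt, hderiv.deriv, he]
  have hsolution := mul_profileSolution_nonpos ht hu
  have hslope := absProfile_add_mul_profileSolution_nonpos ht hu
  set u : ℝ := ⟪e, x⟫_ℝ
  set d : ℝ := (absProfile t u + 2 * u * profileSolution t u) / (1 - u ^ 2) with hd
  have hu2 : 0 < 1 - u ^ 2 := sub_pos.2 ((sq_lt_one_iff_abs_lt_one u).2 hu)
  have hode : (1 - u ^ 2) * d = absProfile t u + 2 * u * profileSolution t u := by
    rw [hd, mul_div_cancel₀ _ hu2.ne']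
  have hd0 : d ≤ 0 := div_nonpos_of_nonpos_of_nonneg hslope hu2.le
  have hE' : (3 : ℝ) ≤ finrank ℝ E := by exact_mod_cast hE
  have hx1 : ‖x‖ ^ 2 < 1 := by simpa using hx
  have hradial := mul_nonneg_of_nonpos_of_nonpos (sub_nonpos.2 hx1.le) hd0
  have hdim := mul_nonneg_of_nonpos_of_nonpos (sub_nonpos.2 hE') hsolution
  linarith

variable [MeasurableSpace E] [BorelSpace E]

theorem integrableOn_ball_of_continuous {f : E → ℝ} (hf : Continuous f) :
    IntegrableOn f (ball 0 1) :=
  (hf.continuousOn.integrableOn_compact (isCompact_closedBall 0 1)).mono_set ball_subset_closedBall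

theorem setIntegral_mul_absProfile_inner_nonpos (hE : 3 ≤ finrank ℝ E) (he : ‖e‖ = 1)
    (ht : |t| < 1) (hw : ContDiff ℝ 1 w) (hws : tsupport w ⊆ Iio 1) (hw0 : ∀ s, 0 ≤ w s) :
    ∫ x in ball 0 1, w (‖x‖ ^ 2) * absProfile t ⟪e, x⟫_ℝ ≤ 0 := by
  have hV : ContDiffOn ℝ 1 (tangentialField e (profileSolution t)) (ball 0 1) :=
    contDiffOn_tangentialField he (contDiffOn_profileSolution t)
  have hwc := hw.continuous
  rw [← setIntegral_divergence_radial_smul_eq_zero hw.contDiffOn hws hV]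
  refine setIntegral_mono_on (integrableOn_ball_of_continuous (by unfold absProfile; fun_prop))
    (integrableOn_divergence_radial_smul hw.contDiffOn hws hV) measurableSet_ball fun x hx ↦ ?_
  rw [divergence_radial_smul (hw.differentiable one_ne_zero _)
    ((hV.contDiffAt (isOpen_ball.mem_nhds hx)).differentiableAt one_ne_zero),
    inner_tangentialField, mul_zero, zero_add]
  exact mul_le_mul_of_nonneg_left
    (absProfile_inner_le_divergence_tangentialField hE he ht hx) (hw0 _)

theorem setIntegral_mul_abs_inner_add_le (hE : 3 ≤ finrank ℝ E) (he : ‖e‖ = 1) (ht : |t| < 1)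
    (hw : ContDiff ℝ 1 w) (hws : tsupport w ⊆ Iio 1) (hw0 : ∀ s, 0 ≤ w s) :
    ∫ x in ball 0 1, w (‖x‖ ^ 2) * |⟪e, x⟫_ℝ + t| ≤
      (1 + t ^ 2) / 2 * ∫ x : E in ball 0 1, w (‖x‖ ^ 2) := by
  have hwc := hw.continuous
  have hint (s : ℝ) : IntegrableOn (fun x : E ↦ w (‖x‖ ^ 2) * |⟪e, x⟫_ℝ + s|) (ball 0 1) :=
    integrableOn_ball_of_continuous (by fun_prop)
  have hreflect : ∫ x in ball 0 1, w (‖x‖ ^ 2) * |⟪e, x⟫_ℝ + -t| =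
      ∫ x in ball 0 1, w (‖x‖ ^ 2) * |⟪e, x⟫_ℝ + t| := by
    have := (Measure.measurePreserving_neg (volume : Measure E)).setIntegral_preimage_emb
      (MeasurableEquiv.neg E).measurableEmbedding
      (fun x ↦ w (‖x‖ ^ 2) * |⟪e, x⟫_ℝ + t|) (ball 0 1)
    rw [← this, neg_preimage, neg_ball, neg_zero]
    simp only [norm_neg, inner_neg_right, ← abs_neg (_ + t), neg_add, neg_neg]
  have hsplit : ∫ x in ball 0 1, w (‖x‖ ^ 2) * absProfile t ⟪e, x⟫_ℝ =
      ((∫ x in ball 0 1, w (‖x‖ ^ 2) * |⟪e, x⟫_ℝ + -t|) +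
        ∫ x in ball 0 1, w (‖x‖ ^ 2) * |⟪e, x⟫_ℝ + t|) / 2 -
        (1 + t ^ 2) / 2 * ∫ x : E in ball 0 1, w (‖x‖ ^ 2) := by
    rw [← integral_add (hint _) (hint _), ← integral_div, ← integral_const_mul, ← integral_sub]
    · refine integral_congr_ae (.of_forall fun x ↦ ?_)
      simp only [absProfile, sub_eq_add_neg]
      ring
    · exact integrableOn_ball_of_continuous (by fun_prop)
    · exact integrableOn_ball_of_continuous (by fun_prop)
  linarith [setIntegral_mul_absProfile_inner_nonpos hE he ht hw hws hw0]

end ProfileInequality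

section DipoleWeight

variable {N : ℕ} {m : ℝ → ℝ} {a s : ℝ}

theorem contDiff_dipoleWeight (N : ℕ) (hm : ContDiff ℝ 2 m) : ContDiff ℝ 1 (dipoleWeight N m) := by
  have : ContDiff ℝ 1 (deriv m) := hm.deriv'
  have hm1 : ContDiff ℝ 1 m := hm.of_le one_le_two
  unfold dipoleWeight
  fun_prop

theorem dipoleWeight_of_notMem_tsupport (hs : s ∉ tsupport m) : dipoleWeight N m s = 0 := by
  rw [dipoleWeight, image_eq_zero_of_notMem_tsupport hs, deriv_of_notMem_tsupport hs, mul_zero,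
    mul_zero, sub_zero]

theorem tsupport_dipoleWeight_subset : tsupport (dipoleWeight N m) ⊆ tsupport m :=
  closure_minimal (fun _ hs ↦ by_contra fun hs' ↦ hs (dipoleWeight_of_notMem_tsupport hs'))
    (isClosed_tsupport m)

/-- A smooth cutoff, equal to `1` on `(-∞, a]` and to `0` on `[(1 + a) / 2, ∞)`. -/
noncomputable def radialCutoff (a s : ℝ) : ℝ := Real.smoothTransition ((1 + a - 2 * s) / (1 - a))

theorem contDiff_radialCutoff (a : ℝ) {k : ℕ∞} : ContDiff ℝ k (radialCutoff a) :=
  Real.smoothTransition.contDiff.comp (by fun_prop)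

theorem radialCutoff_of_le (ha : a < 1) (hs : s ≤ a) : radialCutoff a s = 1 :=
  Real.smoothTransition.one_of_one_le ((one_le_div (by linarith)).2 (by linarith))

theorem radialCutoff_of_ge (ha : a < 1) (hs : (1 + a) / 2 ≤ s) : radialCutoff a s = 0 :=
  Real.smoothTransition.zero_of_nonpos
    (div_nonpos_of_nonpos_of_nonneg (by linarith) (by linarith))

theorem antitone_radialCutoff (ha : a < 1) : Antitone (radialCutoff a) := fun _ _ hs ↦
  Real.smoothTransition.monotone (div_le_div_of_nonneg_right (by linarith) (by linarith))

/-- The truncation at `a` of the density `(1 - s)⁻ᴺ` of the hyperbolic measure, whose dipole weight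
vanishes where the cutoff is constant. -/
noncomputable def hyperbolicWeight (N : ℕ) (a s : ℝ) : ℝ := radialCutoff a s * (1 - s) ^ (-(N : ℤ))

theorem tsupport_hyperbolicWeight_subset (ha : a < 1) : tsupport (hyperbolicWeight N a) ⊆ Iio 1 :=
  tsupport_subset_Iio_iff.2 ⟨(1 + a) / 2, by linarith, fun s hs ↦ by
    rw [hyperbolicWeight, radialCutoff_of_ge ha hs.le, zero_mul]⟩

theorem contDiff_hyperbolicWeight (ha : a < 1) {k : ℕ∞} : ContDiff ℝ k (hyperbolicWeight N a) := by
  refine contDiff_of_tsupport_subset isOpen_Iio ?_ (tsupport_hyperbolicWeight_subset ha)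
  refine (contDiff_radialCutoff a).contDiffOn.mul ?_
  simp only [zpow_neg, zpow_natCast]
  exact ContDiffOn.inv (by fun_prop) fun s hs ↦ pow_ne_zero N (sub_pos.2 hs).ne'

theorem hyperbolicWeight_nonneg (ha : a < 1) (s : ℝ) : 0 ≤ hyperbolicWeight N a s := by
  rcases le_total s 1 with hs | hs
  · exact mul_nonneg (Real.smoothTransition.nonneg _) (zpow_nonneg (sub_nonneg.2 hs) _)
  · rw [hyperbolicWeight, radialCutoff_of_ge ha (by linarith), zero_mul]

theorem hyperbolicWeight_zero (ha : 0 ≤ a) (ha1 : a < 1) : hyperbolicWeight N a 0 = 1 := by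
  rw [hyperbolicWeight, radialCutoff_of_le ha1 ha, sub_zero, one_zpow, one_mul]

theorem dipoleWeight_hyperbolicWeight (hs : s < 1) :
    dipoleWeight N (hyperbolicWeight N a) s =
      -deriv (radialCutoff a) s * ((1 - s) * (1 - s) ^ (-(N : ℤ))) := by
  have hderiv : HasDerivAt (hyperbolicWeight N a) _ s :=
    ((contDiff_radialCutoff (k := 1) a).differentiable one_ne_zero s).hasDerivAt.mul
      (hasDerivAt_one_sub_zpow_neg N hs)
  have hs' : 1 - s ≠ 0 := (sub_pos.2 hs).ne'
  rw [dipoleWeight, hderiv.deriv, hyperbolicWeight, zpow_sub_one₀ hs']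
  field_simp
  push_cast
  ring

theorem dipoleWeight_hyperbolicWeight_nonneg (ha : a < 1) (s : ℝ) :
    0 ≤ dipoleWeight N (hyperbolicWeight N a) s := by
  rcases lt_or_ge s 1 with hs | hs
  · have : 0 < 1 - s := sub_pos.2 hs
    have : 0 ≤ -deriv (radialCutoff a) s := neg_nonneg.2 (antitone_radialCutoff ha).deriv_nonpos
    rw [dipoleWeight_hyperbolicWeight hs]
    positivity
  · exact (dipoleWeight_of_notMem_tsupport fun hs' ↦
      hs.not_gt (tsupport_hyperbolicWeight_subset ha hs')).ge

theorem dipoleWeight_hyperbolicWeight_of_lt (ha : a < 1) (hs : s < a) :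
    dipoleWeight N (hyperbolicWeight N a) s = 0 := by
  have : radialCutoff a =ᶠ[𝓝 s] fun _ ↦ 1 :=
    (gt_mem_nhds hs).mono fun y hy ↦ radialCutoff_of_le ha (le_of_lt hy)
  rw [dipoleWeight_hyperbolicWeight (hs.trans ha), this.deriv_eq, deriv_const, neg_zero, zero_mul]

variable {E : Type*} [NormedAddCommGroup E] [InnerProductSpace ℝ E] [FiniteDimensional ℝ E]
  [MeasurableSpace E] [BorelSpace E]

theorem setIntegral_hyperbolicWeight_pos (ha : 0 ≤ a) (ha1 : a < 1) :
    0 < ∫ x : E in ball 0 1, hyperbolicWeight N a (‖x‖ ^ 2) := by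
  have hsupp := tsupport_comp_norm_sq_subset (E := E)
    (tsupport_hyperbolicWeight_subset (N := N) ha1)
  rw [setIntegral_eq_integral_of_forall_compl_eq_zero fun x hx ↦
    image_eq_zero_of_notMem_tsupport fun hx' ↦ hx (hsupp hx')]
  refine Continuous.integral_pos_of_hasCompactSupport_nonneg_nonzero
    ((contDiff_hyperbolicWeight (k := 0) ha1).continuous.comp (by fun_prop))
    (hasCompactSupport_of_tsupport_subset_ball hsupp) (fun x ↦ hyperbolicWeight_nonneg ha1 _)
    (x := 0) ?_
  rw [norm_zero, zero_pow two_ne_zero, hyperbolicWeight_zero ha ha1]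
  exact one_ne_zero

theorem setIntegral_norm_sq_mul_dipoleWeight (hm : ContDiff ℝ 1 m) (hms : tsupport m ⊆ Iio 1) :
    ∫ x : E in ball 0 1, ‖x‖ ^ 2 * dipoleWeight (finrank ℝ E) m (‖x‖ ^ 2) =
      ∫ x : E in ball 0 1, (finrank ℝ E + (finrank ℝ E - 2) * ‖x‖ ^ 2) / 2 * m (‖x‖ ^ 2) := by
  have := hm.continuous_deriv_one
  have hmc := hm.continuous
  have hg : ContDiff ℝ 1 fun s ↦ (1 - s) * m s := by fun_prop
  have hderiv (s : ℝ) : deriv (fun s ↦ (1 - s) * m s) s = -m s + (1 - s) * deriv m s :=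
    ((((hasDerivAt_id s).const_sub 1).mul
      (hm.differentiable one_ne_zero s).hasDerivAt).congr_deriv (by rw [id, neg_one_mul])).deriv
  have hdiv (x : E) : divergence (fun y ↦ ((1 - ‖y‖ ^ 2) * m (‖y‖ ^ 2)) • y) x =
      2 * ((finrank ℝ E + (finrank ℝ E - 2) * ‖x‖ ^ 2) / 2 * m (‖x‖ ^ 2) -
        ‖x‖ ^ 2 * dipoleWeight (finrank ℝ E) m (‖x‖ ^ 2)) := by
    rw [divergence_radial_smul (m := fun s ↦ (1 - s) * m s) (V := fun y ↦ y)
      (hg.differentiable one_ne_zero _) differentiableAt_fun_id, hderiv, divergence_id,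
      real_inner_self_eq_norm_sq, dipoleWeight]
    ring
  have hzero := setIntegral_divergence_radial_smul_eq_zero (E := E) hg.contDiffOn
    (tsupport_mul_subset_right.trans hms) contDiffOn_fun_id
  simp only [hdiv] at hzero
  rw [integral_const_mul, integral_sub] at hzero
  · linarith
  · exact integrableOn_ball_of_continuous (by fun_prop)
  · exact integrableOn_ball_of_continuous (by unfold dipoleWeight; fun_prop)

theorem mul_setIntegral_dipoleWeight_le (hE : 2 ≤ finrank ℝ E) (hm : ContDiff ℝ 1 m)
    (hms : tsupport m ⊆ Iio 1) (hm0 : ∀ s, 0 ≤ m s)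
    (hw0 : ∀ s, 0 ≤ dipoleWeight (finrank ℝ E) m s)
    (hwa : ∀ s < a, dipoleWeight (finrank ℝ E) m s = 0) :
    a * ∫ x : E in ball 0 1, dipoleWeight (finrank ℝ E) m (‖x‖ ^ 2) ≤
      (finrank ℝ E - 1) * ∫ x : E in ball 0 1, m (‖x‖ ^ 2) := by
  have := hm.continuous_deriv_one
  have hmc := hm.continuous
  have hwc : Continuous (dipoleWeight (finrank ℝ E) m) := by unfold dipoleWeight; fun_prop
  have hE' : (2 : ℝ) ≤ finrank ℝ E := by exact_mod_cast hE
  rw [← integral_const_mul, ← integral_const_mul]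
  calc
    _ ≤ ∫ x : E in ball 0 1, ‖x‖ ^ 2 * dipoleWeight (finrank ℝ E) m (‖x‖ ^ 2) := by
      refine setIntegral_mono (integrableOn_ball_of_continuous (by fun_prop))
        (integrableOn_ball_of_continuous (by fun_prop)) fun x ↦ ?_
      rcases lt_or_ge (‖x‖ ^ 2) a with hx | hx
      · simp only [hwa _ hx, mul_zero, le_refl]
      · exact mul_le_mul_of_nonneg_right hx (hw0 _)
    _ = ∫ x : E in ball 0 1, (finrank ℝ E + (finrank ℝ E - 2) * ‖x‖ ^ 2) / 2 * m (‖x‖ ^ 2) :=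
      setIntegral_norm_sq_mul_dipoleWeight hm hms
    _ ≤ _ := by
      refine setIntegral_mono_on (integrableOn_ball_of_continuous (by fun_prop))
        (integrableOn_ball_of_continuous (by fun_prop)) measurableSet_ball fun x hx ↦ ?_
      have hx1 : ‖x‖ ^ 2 < 1 := by simpa using hx
      exact mul_le_mul_of_nonneg_right (by nlinarith) (hm0 _)

end DipoleWeight

section Origin

variable {n : ℕ} {h : EuclideanSpace ℝ (Fin n) → ℝ} {e : EuclideanSpace ℝ (Fin n)} {m : ℝ → ℝ}
  {a : ℝ}

theorem IsHyperbolicHarmonic.integrableOn_ball (hh : IsHyperbolicHarmonic h)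
    (hmaps : MapsTo h (ball 0 1) (Ioo (-1) 1)) : IntegrableOn h (ball 0 1) :=
  ⟨hh.1.continuousOn.aestronglyMeasurable measurableSet_ball,
    .restrict_of_bounded (C := 1) measure_ball_lt_top
      ((ae_restrict_mem measurableSet_ball).mono fun _ hx ↦ (abs_lt.2 (hmaps hx)).le)⟩

theorem IsHyperbolicHarmonic.integral_mul_fderiv_zero_apply_le (hh : IsHyperbolicHarmonic h)
    (hn : 3 ≤ n) (hmaps : MapsTo h (ball 0 1) (Ioo (-1) 1)) (he : ‖e‖ = 1) (hm : ContDiff ℝ 2 m)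
    (hms : tsupport m ⊆ Iio 1) (hw0 : ∀ s, 0 ≤ dipoleWeight n m s) :
    (∫ x : EuclideanSpace ℝ (Fin n) in ball 0 1, m (‖x‖ ^ 2)) * fderiv ℝ h 0 e ≤
      (1 - h 0 ^ 2) * ∫ x : EuclideanSpace ℝ (Fin n) in ball 0 1, dipoleWeight n m (‖x‖ ^ 2) := by
  have hw := contDiff_dipoleWeight n hm
  have hws := (tsupport_dipoleWeight_subset (N := n)).trans hms
  have hwc := hw.continuous
  have hint := hh.integrableOn_ball hmaps
  have hint_mul {g : EuclideanSpace ℝ (Fin n) → ℝ} (hg : Continuous g) :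
      IntegrableOn (fun x ↦ h x * g x) (ball 0 1) :=
    hint.mul_continuousOn_of_subset hg.continuousOn measurableSet_ball (isCompact_closedBall 0 1)
      ball_subset_closedBall
  have hmean := hh.integral_radial_mul hwc hws
  have hgrad := hh.fderiv_zero_apply_mul_integral hint (hm.of_le one_le_two) hms he
  have h0 : |h 0| < 1 := abs_lt.2 (hmaps (mem_ball_self one_pos))
  have hprofile := setIntegral_mul_abs_inner_add_le (by rwa [finrank_euclideanSpace_fin]) he h0
    hw hws hw0
  have hsign : ∫ x in ball 0 1, h x * (2 * (⟪e, x⟫_ℝ + h 0) * dipoleWeight n m (‖x‖ ^ 2)) ≤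
      ∫ x in ball 0 1, 2 * (dipoleWeight n m (‖x‖ ^ 2) * |⟪e, x⟫_ℝ + h 0|) := by
    refine setIntegral_mono_on (hint_mul (by fun_prop))
      (integrableOn_ball_of_continuous (by fun_prop)) measurableSet_ball fun x hx ↦ ?_
    have : h x * (⟪e, x⟫_ℝ + h 0) ≤ |⟪e, x⟫_ℝ + h 0| := by
      refine (le_abs_self _).trans ?_
      rw [abs_mul]
      exact mul_le_of_le_one_left (abs_nonneg _) (abs_lt.2 (hmaps hx)).le
    nlinarith [mul_le_mul_of_nonneg_left this (hw0 (‖x‖ ^ 2))]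
  have hsplit : ∫ x in ball 0 1, h x * (2 * (⟪e, x⟫_ℝ + h 0) * dipoleWeight n m (‖x‖ ^ 2)) =
      (∫ x in ball 0 1, h x * (2 * ⟪e, x⟫_ℝ * dipoleWeight n m (‖x‖ ^ 2))) +
        2 * h 0 * ∫ x in ball 0 1, dipoleWeight n m (‖x‖ ^ 2) * h x := by
    rw [← integral_const_mul, ← integral_add (hint_mul (by fun_prop))]
    · exact integral_congr_ae (.of_forall fun x ↦ by ring)
    · simpa only [mul_comm] using (hint_mul (by fun_prop)).const_mul (2 * h 0)
  rw [hsplit, ← hgrad, hmean, integral_const_mul] at hsign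
  linarith

theorem IsHyperbolicHarmonic.mul_fderiv_zero_apply_le (hh : IsHyperbolicHarmonic h) (hn : 3 ≤ n)
    (hmaps : MapsTo h (ball 0 1) (Ioo (-1) 1)) (he : ‖e‖ = 1) (ha : a ∈ Ioo 0 1) :
    a * fderiv ℝ h 0 e ≤ (n - 1) * (1 - h 0 ^ 2) := by
  have hms := tsupport_hyperbolicWeight_subset (N := n) ha.2
  have hw0 := dipoleWeight_hyperbolicWeight_nonneg (N := n) ha.2
  have hupper := hh.integral_mul_fderiv_zero_apply_le hn hmaps he
    (contDiff_hyperbolicWeight (k := 2) ha.2) hms hw0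
  have hmass := mul_setIntegral_dipoleWeight_le (E := EuclideanSpace ℝ (Fin n)) (a := a)
    (m := hyperbolicWeight n a) (by rw [finrank_euclideanSpace_fin]; omega)
    (contDiff_hyperbolicWeight (k := 1) ha.2) hms (hyperbolicWeight_nonneg ha.2)
  rw [finrank_euclideanSpace_fin] at hmass
  replace hmass := hmass hw0 fun s hs ↦ dipoleWeight_hyperbolicWeight_of_lt ha.2 hs
  have hpos := setIntegral_hyperbolicWeight_pos (E := EuclideanSpace ℝ (Fin n)) (N := n)
    ha.1.le ha.2
  have h0 : 0 ≤ 1 - h 0 ^ 2 :=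
    sub_nonneg.2 ((sq_lt_one_iff_abs_lt_one _).2 (abs_lt.2 (hmaps (mem_ball_self one_pos)))).le
  refine le_of_mul_le_mul_left ?_ hpos
  nlinarith [mul_le_mul_of_nonneg_left hupper ha.1.le, mul_le_mul_of_nonneg_left hmass h0]

theorem IsHyperbolicHarmonic.fderiv_zero_apply_le (hh : IsHyperbolicHarmonic h) (hn : 3 ≤ n)
    (hmaps : MapsTo h (ball 0 1) (Ioo (-1) 1)) (he : ‖e‖ = 1) :
    fderiv ℝ h 0 e ≤ (n - 1) * (1 - h 0 ^ 2) := by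
  have hlim : Tendsto (fun a ↦ a * fderiv ℝ h 0 e) (𝓝[<] 1) (𝓝 (1 * fderiv ℝ h 0 e)) :=
    (Continuous.tendsto (by fun_prop) _).mono_left nhdsWithin_le_nhds
  rw [one_mul] at hlim
  refine le_of_tendsto hlim ?_
  filter_upwards [Ioo_mem_nhdsLT zero_lt_one] with a ha
  exact hh.mul_fderiv_zero_apply_le hn hmaps he ha

end Origin

section Pointwise

variable {n : ℕ} {h : EuclideanSpace ℝ (Fin n) → ℝ} {x v : EuclideanSpace ℝ (Fin n)}

theorem IsHyperbolicHarmonic.fderiv_apply_le (hh : IsHyperbolicHarmonic h) (hn : 3 ≤ n)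
    (hmaps : MapsTo h (ball 0 1) (Ioo (-1) 1)) (hx : x ∈ ball 0 1) (hv : ‖v‖ = 1) :
    fderiv ℝ h x v ≤ (n - 1) * ((1 - h x ^ 2) / (1 - ‖x‖ ^ 2)) := by
  rcases eq_or_ne x 0 with rfl | hx0
  · simpa using hh.fderiv_zero_apply_le hn hmaps hv
  have hx1 : ‖x‖ ^ 2 < 1 := by simpa using hx
  have hxpos : 0 < ‖x‖ := norm_pos_iff.2 hx0
  set c := (‖x‖ ^ 2)⁻¹ • x with hcdef
  have hnorm : ‖c‖ = ‖x‖⁻¹ := by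
    rw [hcdef, norm_smul, norm_inv, norm_pow, norm_norm]
    field_simp
  have hc : 1 < ‖c‖ := hnorm ▸ (one_lt_inv₀ hxpos).2 (mem_ball_zero_iff.1 hx)
  have hc0 : c ≠ 0 := norm_pos_iff.1 (one_pos.trans hc)
  have hzero : ballInversion c 0 = x := by
    rw [ballInversion_zero hc, hnorm, hcdef, smul_smul]
    field_simp
    rw [one_smul]
  have hfactor : ballInversionFactor c 0 = 1 - ‖x‖ ^ 2 := by
    rw [ballInversionFactor_zero hc0, hnorm, inv_pow, inv_inv]
  set R := (ℝ ∙ (0 - c))ᗮ.reflection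
  have hderiv : HasFDerivAt (h ∘ ballInversion c)
      (fderiv ℝ h x ∘L ((1 - ‖x‖ ^ 2) • (R : _ →L[ℝ] EuclideanSpace ℝ (Fin n)))) 0 := by
    refine HasFDerivAt.comp 0 ?_ (hfactor ▸ hasFDerivAt_ballInversion hc hc0.symm)
    rw [hzero]
    exact ((hh.1.contDiffAt (isOpen_ball.mem_nhds hx)).differentiableAt two_ne_zero).hasFDerivAt
  have hbound := (hh.comp_ballInversion hc).fderiv_zero_apply_le hn
    (hmaps.comp (mapsTo_ballInversion hc)) (e := R v) (by rw [LinearIsometryEquiv.norm_map, hv])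
  rw [hderiv.fderiv, Function.comp_apply, hzero] at hbound
  rw [mul_div_assoc', le_div_iff₀ (sub_pos.2 hx1), mul_comm]
  simpa [R] using hbound

theorem IsHyperbolicHarmonic.norm_fderiv_le (hh : IsHyperbolicHarmonic h) (hn : 3 ≤ n)
    (hmaps : MapsTo h (ball 0 1) (Ioo (-1) 1)) (hx : x ∈ ball 0 1) :
    ‖fderiv ℝ h x‖ ≤ (n - 1) * ((1 - h x ^ 2) / (1 - ‖x‖ ^ 2)) := by
  have hx1 : ‖x‖ ^ 2 < 1 := by simpa using hx
  have hhx : 0 ≤ 1 - h x ^ 2 :=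
    sub_nonneg.2 ((sq_lt_one_iff_abs_lt_one _).2 (abs_lt.2 (hmaps hx))).le
  have hn' : (3 : ℝ) ≤ n := by exact_mod_cast hn
  refine ContinuousLinearMap.opNorm_le_of_unit_norm
    (mul_nonneg (by linarith) (div_nonneg hhx (sub_pos.2 hx1).le)) fun v hv ↦ abs_le'.2 ⟨?_, ?_⟩
  · exact hh.fderiv_apply_le hn hmaps hx hv
  · rw [← map_neg]
    exact hh.fderiv_apply_le hn hmaps hx (by rwa [norm_neg])

theorem norm_gradient_eq_norm_fderiv {E : Type*} [NormedAddCommGroup E] [InnerProductSpace ℝ E]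
    [CompleteSpace E] (f : E → ℝ) (x : E) : ‖gradient f x‖ = ‖fderiv ℝ f x‖ :=
  LinearIsometryEquiv.norm_map _ _

end Pointwise

section HyperbolicLength

variable {n m : ℕ} {x y : EuclideanSpace ℝ (Fin n)} {γ : ℝ → EuclideanSpace ℝ (Fin n)}
  {F : EuclideanSpace ℝ (Fin n) → EuclideanSpace ℝ (Fin m)} {K : ℝ}

theorem one_sub_norm_sq_pos (hx : x ∈ unitBall n) : 0 < 1 - ‖x‖ ^ 2 := by
  simpa [unitBall] using hx

theorem IsBallCurve.lineMap (hx : x ∈ unitBall n) (hy : y ∈ unitBall n) :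
    IsBallCurve (AffineMap.lineMap x y) x y where
  contDiffOn := (ContinuousAffineMap.lineMap (R := ℝ) x y).contDiff.contDiffOn
  mapsTo _ ht := (convex_ball 0 1).lineMap_mem hx hy ht
  source := AffineMap.lineMap_apply_zero x y
  target := AffineMap.lineMap_apply_one x y

theorem IsBallCurve.comp (hγ : IsBallCurve γ x y) (hF : ContDiffOn ℝ 1 F (unitBall n))
    (hmaps : MapsTo F (unitBall n) (unitBall m)) : IsBallCurve (F ∘ γ) (F x) (F y) where
  contDiffOn := hF.comp hγ.contDiffOn hγ.mapsTo
  mapsTo := hmaps.comp hγ.mapsTo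
  source := congrArg F hγ.source
  target := congrArg F hγ.target

theorem IsBallCurve.intervalIntegrable_speed (hγ : IsBallCurve γ x y) :
    IntervalIntegrable (fun t ↦ 2 * ‖derivWithin γ (Icc 0 1) t‖ / (1 - ‖γ t‖ ^ 2)) volume 0 1 := by
  have hderiv : ContinuousOn (derivWithin γ (Icc 0 1)) (Icc 0 1) :=
    hγ.contDiffOn.continuousOn_derivWithin (uniqueDiffOn_Icc zero_lt_one) le_rfl
  have hcont := hγ.contDiffOn.continuousOn
  exact ContinuousOn.intervalIntegrable_of_Icc zero_le_one <|
    ContinuousOn.div (by fun_prop) (by fun_prop) fun t ht ↦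
      (one_sub_norm_sq_pos (hγ.mapsTo ht)).ne'

theorem IsBallCurve.hyperbolicLength_nonneg (hγ : IsBallCurve γ x y) : 0 ≤ hyperbolicLength γ :=
  intervalIntegral.integral_nonneg zero_le_one fun _ ht ↦
    div_nonneg (by positivity) (one_sub_norm_sq_pos (hγ.mapsTo ht)).le

theorem IsBallCurve.hyperbolicDist_le (hγ : IsBallCurve γ x y) :
    hyperbolicDist x y ≤ hyperbolicLength γ :=
  csInf_le ⟨0, fun _ ⟨_, hδ, hL⟩ ↦ hL ▸ hδ.hyperbolicLength_nonneg⟩ ⟨γ, hγ, rfl⟩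

theorem IsBallCurve.hyperbolicLength_comp_le (hγ : IsBallCurve γ x y)
    (hF : ContDiffOn ℝ 1 F (unitBall n)) (hmaps : MapsTo F (unitBall n) (unitBall m))
    (hbound : ∀ z ∈ unitBall n, ‖fderiv ℝ F z‖ ≤ K * ((1 - ‖F z‖ ^ 2) / (1 - ‖z‖ ^ 2))) :
    hyperbolicLength (F ∘ γ) ≤ K * hyperbolicLength γ := by
  rw [hyperbolicLength, hyperbolicLength, ← intervalIntegral.integral_const_mul]
  refine intervalIntegral.integral_mono_on zero_le_one (hγ.comp hF hmaps).intervalIntegrable_speed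
    (hγ.intervalIntegrable_speed.const_mul K) fun t ht ↦ ?_
  have hγt := hγ.mapsTo ht
  have hFderiv := ((hF.contDiffAt (isOpen_ball.mem_nhds hγt)).differentiableAt
    one_ne_zero).hasFDerivAt
  have hγderiv := (hγ.contDiffOn.differentiableOn one_ne_zero t ht).hasDerivWithinAt
  rw [(hFderiv.comp_hasDerivWithinAt t hγderiv).derivWithin (uniqueDiffOn_Icc zero_lt_one t ht),
    Function.comp_apply, div_le_iff₀ (one_sub_norm_sq_pos (hmaps hγt))]
  calc 2 * ‖fderiv ℝ F (γ t) (derivWithin γ (Icc 0 1) t)‖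
      ≤ 2 * (K * ((1 - ‖F (γ t)‖ ^ 2) / (1 - ‖γ t‖ ^ 2)) * ‖derivWithin γ (Icc 0 1) t‖) := by
        gcongr
        exact ContinuousLinearMap.le_of_opNorm_le _ (hbound _ hγt) _
    _ = K * (2 * ‖derivWithin γ (Icc 0 1) t‖ / (1 - ‖γ t‖ ^ 2)) * (1 - ‖F (γ t)‖ ^ 2) := by ring

theorem hyperbolicDist_map_le (hF : ContDiffOn ℝ 1 F (unitBall n))
    (hmaps : MapsTo F (unitBall n) (unitBall m))
    (hbound : ∀ z ∈ unitBall n, ‖fderiv ℝ F z‖ ≤ K * ((1 - ‖F z‖ ^ 2) / (1 - ‖z‖ ^ 2)))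
    (hx : x ∈ unitBall n) (hy : y ∈ unitBall n) :
    hyperbolicDist (F x) (F y) ≤ K * hyperbolicDist x y := by
  have hK : 0 ≤ K := nonneg_of_mul_nonneg_left ((norm_nonneg _).trans (hbound x hx))
    (div_pos (one_sub_norm_sq_pos (hmaps hx)) (one_sub_norm_sq_pos hx))
  rw [hyperbolicDist.eq_def x y, ← smul_eq_mul, ← Real.sInf_smul_of_nonneg hK]
  refine le_csInf (.smul_set ⟨_, _, .lineMap hx hy, rfl⟩) ?_
  rintro _ ⟨_, ⟨γ, hγ, rfl⟩, rfl⟩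
  exact (hγ.comp hF hmaps).hyperbolicDist_le.trans (hγ.hyperbolicLength_comp_le hF hmaps hbound)

end HyperbolicLength

section Diameter

/-- The isometric embedding `t ↦ (t, 0)` of the real line onto the axis that cuts the unit disc in
its real diameter. -/
noncomputable def diameterEmbedding : ℝ →ₗᵢ[ℝ] EuclideanSpace ℝ (Fin 2) :=
  LinearIsometry.toSpanSingleton ℝ _ (v := !₂[1, 0]) (by simp [EuclideanSpace.norm_eq])

theorem diameterEmbedding_apply (t : ℝ) : diameterEmbedding t = !₂[t, 0] := by
  ext i
  fin_cases i <;> simp [diameterEmbedding]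

theorem norm_fderiv_diameterEmbedding_comp {E : Type*} [NormedAddCommGroup E] [NormedSpace ℝ E]
    {f : E → ℝ} {z : E} (hf : DifferentiableAt ℝ f z) :
    ‖fderiv ℝ (diameterEmbedding ∘ f) z‖ = ‖fderiv ℝ f z‖ := by
  have := (diameterEmbedding.toContinuousLinearMap.hasFDerivAt.comp z hf.hasFDerivAt).fderiv
  rw [← LinearIsometry.norm_toContinuousLinearMap_comp diameterEmbedding, ← this]
  rfl

theorem IsHyperbolicHarmonic.hyperbolicDist_map_le {n : ℕ} {h : EuclideanSpace ℝ (Fin n) → ℝ}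
    {x y : EuclideanSpace ℝ (Fin n)} (hh : IsHyperbolicHarmonic h) (hn : 3 ≤ n)
    (hmaps : MapsTo h (unitBall n) (Ioo (-1) 1)) (hx : x ∈ unitBall n) (hy : y ∈ unitBall n) :
    hyperbolicDist (!₂[h x, 0] : EuclideanSpace ℝ (Fin 2)) !₂[h y, 0] ≤
      (n - 1) * hyperbolicDist x y := by
  simp only [← diameterEmbedding_apply]
  refine _root_.hyperbolicDist_map_le (F := diameterEmbedding ∘ h)
    (diameterEmbedding.contDiff.comp_contDiffOn (hh.1.of_le one_le_two)) (fun z hz ↦ ?_)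
    (fun z hz ↦ ?_) hx hy
  · simpa [unitBall, abs_lt] using hmaps hz
  · have hz' := ((hh.1.contDiffAt (isOpen_ball.mem_nhds hz)).differentiableAt two_ne_zero)
    simpa [norm_fderiv_diameterEmbedding_comp hz'] using hh.norm_fderiv_le hn hmaps hz

end Diameter

/-- A hyperbolic harmonic function `h : 𝔹ⁿ → (-1, 1)`, `n ≥ 3`, satisfies a pointwise gradient
estimate and is `(n - 1)`-Lipschitz from the hyperbolic distance of the ball to the Poincaré
distance of the unit disc, in which `(-1, 1)` is the real diameter. -/
theorem mainTheorem5 (n : ℕ) (hn : 3 ≤ n) (h : EuclideanSpace ℝ (Fin n) → ℝ)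
    (hmaps : ∀ x ∈ unitBall n, h x ∈ Set.Ioo (-1 : ℝ) 1)
    (hharm : IsHyperbolicHarmonic h) :
    (∀ x ∈ unitBall n, ‖gradient h x‖ ≤ ((n : ℝ) - 1) * ((1 - |h x| ^ 2) / (1 - ‖x‖ ^ 2))) ∧
    (∀ x₁ ∈ unitBall n, ∀ x₂ ∈ unitBall n,
      hyperbolicDist (!₂[h x₁, 0] : EuclideanSpace ℝ (Fin 2)) !₂[h x₂, 0]
        ≤ ((n : ℝ) - 1) * hyperbolicDist x₁ x₂) := by
  refine ⟨fun x hx ↦ ?_, fun x₁ hx₁ x₂ hx₂ ↦ hharm.hyperbolicDist_map_le hn hmaps hx₁ hx₂⟩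
  rw [norm_gradient_eq_norm_fderiv, sq_abs]
  exact hharm.norm_fderiv_le hn hmaps hx
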